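/- Theorem. Call $K\subset\mathbb R^2$ a symmetric convex body if it is nonempty, open, convex, bounded and satisfies $-K=K$. Let $K^\circ=\{\xi\in\mathbb R^2 : x\cdot\xi<1\ \ \forall x\in K\}$ be its polar dual, $M(K)=|K|\,|K^\circ|$ its Mahler volume, and $h_K(\theta)=\sup_{x\in K} x\cdot(\cos\theta,\sin\theta)$ its support function, a function on $\mathbb T=\mathbb R/2\pi\mathbb Z$. Let $K$ be a symmetric convex body in $\mathbb R^2$ which is a local minimizer of the Mahler volume among symmetric convex bodies, in the sense that there exists $\varepsilon>0$ such that $M(K)\le M(L)$ for every symmetric convex body $L\subset\mathbb R^2$ with $\|h_L-h_K\|_{H^1(\mathbb T)}\le\varepsilon$, where $\|f\|_{H^1(\mathbb T)}^2=\int_{\mathbb T}(f^2+f'^2)\,d\theta$ with $f'$ the weak derivative of $f$. Then $K$ is a parallelogram. -/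

import Mathlib

namespace MahlerVolume

open scoped Pointwise ContDiff

/-- A convex body of `ℝ^d`: a nonempty, open, convex and bounded set. -/
structure IsConvexBody {d : ℕ} (K : Set (EuclideanSpace ℝ (Fin d))) : Prop where
  nonempty : K.Nonempty
  isOpen : IsOpen K
  convex : Convex ℝ K
  isBounded : Bornology.IsBounded K

/-- A convex body which is centrally symmetric, `-K = K`. -/
structure IsSymmConvexBody {d : ℕ} (K : Set (EuclideanSpace ℝ (Fin d))) : Prop
    extends IsConvexBody K where
  symm : -K = K

/-- The polar dual of `K`. -/
def polarDual {d : ℕ} (K : Set (EuclideanSpace ℝ (Fin d))) : Set (EuclideanSpace ℝ (Fin d)) :=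
  {ξ | ∀ x ∈ K, inner ℝ x ξ < 1}

/-- The Mahler volume `|K| |K°|`. -/
noncomputable def mahlerVolume {d : ℕ} (K : Set (EuclideanSpace ℝ (Fin d))) : ENNReal :=
  MeasureTheory.volume K * MeasureTheory.volume (polarDual K)

/-- The support function of a planar convex body, as a `2π`-periodic function of the angle:
`h_K(θ) = sup {x · (cos θ, sin θ) : x ∈ K}`. -/
noncomputable def supportFun (K : Set (EuclideanSpace ℝ (Fin 2))) (θ : ℝ) : ℝ :=
  sSup ((fun x => inner ℝ x !₂[Real.cos θ, Real.sin θ]) '' K)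

/-- Lebesgue measure on one period `(0, 2π]` of the circle `ℝ / 2πℤ`. -/
noncomputable def circleMeasure : MeasureTheory.Measure ℝ :=
  MeasureTheory.volume.restrict (Set.Ioc 0 (2 * Real.pi))

/-- `f ∈ H¹(ℝ / 2πℤ)` with weak derivative `g`: both are square integrable over a period, and the
integration by parts formula holds against every smooth `2π`-periodic test function. -/
structure HasH1Deriv (f g : ℝ → ℝ) : Prop where
  memLp : MeasureTheory.MemLp f 2 circleMeasure
  memLp_deriv : MeasureTheory.MemLp g 2 circleMeasure
  integral_eq : ∀ φ : ℝ → ℝ, ContDiff ℝ ∞ φ → Function.Periodic φ (2 * Real.pi) →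
    ∫ θ, f θ * deriv φ θ ∂circleMeasure = -∫ θ, g θ * φ θ ∂circleMeasure

/-- The norm `(∫ f² + ∫ f'²)^{1/2}` of `H¹(ℝ / 2πℤ)`, equal to `∞` when `f ∉ H¹`. (The weak
derivative is unique up to null sets, so that the infimum is over a single value.) -/
noncomputable def h1Norm (f : ℝ → ℝ) : ENNReal :=
  ⨅ (g : ℝ → ℝ) (_ : HasH1Deriv f g),
    ENNReal.ofReal (Real.sqrt ((∫ θ, f θ ^ 2 ∂circleMeasure) + ∫ θ, g θ ^ 2 ∂circleMeasure))

/-- `K` is a symmetric convex body which minimizes the Mahler volume among all symmetric convex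
bodies whose support function is close to that of `K` in `H¹`. -/
def IsLocalMinimizer (K : Set (EuclideanSpace ℝ (Fin 2))) : Prop :=
  IsSymmConvexBody K ∧ ∃ ε : ℝ, 0 < ε ∧ ∀ L : Set (EuclideanSpace ℝ (Fin 2)),
    IsSymmConvexBody L → h1Norm (fun θ => supportFun L θ - supportFun K θ) ≤ ENNReal.ofReal ε →
      mahlerVolume K ≤ mahlerVolume L

/-- `K` is a nondegenerate (open) parallelogram. -/
def IsParallelogram (K : Set (EuclideanSpace ℝ (Fin 2))) : Prop :=
  ∃ a u v : EuclideanSpace ℝ (Fin 2), LinearIndependent ℝ ![u, v] ∧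
    K = {x | ∃ s ∈ Set.Ioo (0 : ℝ) 1, ∃ t ∈ Set.Ioo (0 : ℝ) 1, x = a + s • u + t • v}

end MahlerVolume

/-!
A symmetric convex body is `K = {(x, y) : |y| < b, -g (-y) < x < g y}` with `g` concave and continuous
on `[-b, b]` (`exists_profile`). Move the points at height `y` of the right boundary horizontally by
`t β(y)`, and the left boundary symmetrically, where `β 0 = 0` and `g + t β` stays concave for small
`|t|`; if the top `y = b` of `K` is a vertex, require also `β b + β (-b) = 0`.

* The area is affine in `t` (`volume_body_midpoint`).
* The area of the polar body is concave in `t` (`volume_polar_midpoint`). Indeed the slice of the polar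
  body at abscissa `s` is, for all `t`, empty or not together, and the pairs `(t, η)` with `η` in the
  slice form a convex set, so that the length of the slice is concave in `t`.

A product of an affine and a concave positive function has a midpoint minimum at `t = 0` only if the
first is constant and the second is affine. Then every slice of the polar body has a length affine in
`t`. The ends of the slices are the slopes of the lines through a point `(m, 0)` that support the
boundary of `K`, and a contact point of such a line must stay one along the deformation. This
determines how the concave function `g` moves: `β` is linear on `y > 0` and on `y < 0`
(`eq_const_mul_of_tangentSlope_midpoint`), and by constancy of the area it is linear. So only shears
are admissible (`linear_of_isLocalMinimizer`). The deformed bodies are close to `K` in `H¹`, because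
support functions are semiconvex, which upgrades uniform convergence to almost everywhere convergence
of the derivatives (`eventually_h1Norm_le`).

It remains to exhibit admissible `β`. If the top of `K` is an edge, `β = g - g 0` is admissible, so `g`
is affine and `K` is a parallelogram. If the top is a vertex, there are two linear constraints on `β`
and, whenever `g` has curvature on both sides of some `c`, three independent candidates: the constant
`1`, `g`, and the part of `g` that carries the curvature above `c`. Hence `g` has at most one corner
and `K` is again a parallelogram.
-/

namespace MahlerVolume

open Set Filter Topology MeasureTheory

/-! ### Concave functions of one variable -/

theorem exists_supergradient {s : Set ℝ} {f : ℝ → ℝ} (hf : ConcaveOn ℝ s f) {y : ℝ}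
    (hy : y ∈ interior s) : ∃ p, ∀ z ∈ s, f z ≤ f y + p * (z - y) := by
  have hc : ConvexOn ℝ s (-f) := hf.neg
  have hys := interior_subset hy
  refine ⟨-derivWithin (-f) (Ioi y) y, fun z hz => ?_⟩
  rcases lt_trichotomy z y with h | rfl | h
  · have h1 := hc.slope_le_leftDeriv_of_mem_interior hz hy h
    have h2 := hc.leftDeriv_le_rightDeriv_of_mem_interior hy
    have h3 := h1.trans h2
    rw [slope_def_field, div_le_iff₀ (by linarith)] at h3
    simp only [Pi.neg_apply] at h3
    linarith
  · simp
  · have h3 := hc.rightDeriv_le_slope_of_mem_interior hy hz h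
    rw [slope_def_field, le_div_iff₀ (by linarith)] at h3
    simp only [Pi.neg_apply] at h3
    linarith

theorem exists_abs_le_of_concaveOn {f : ℝ → ℝ} {b : ℝ} (hb : 0 < b)
    (hf : ConcaveOn ℝ (Icc (-b) b) f) : ∃ B, ∀ y ∈ Icc (-b) b, |f y| ≤ B := by
  obtain ⟨p, hp⟩ := exists_supergradient hf (y := 0) (by rw [interior_Icc]; constructor <;> linarith)
  refine ⟨|f 0| + |p| * b + |f b| + |f (-b)|, fun y hy => ?_⟩
  have h1 := hp y hy
  have h2 : p * (y - 0) ≤ |p| * b := by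
    calc p * (y - 0) ≤ |p * (y - 0)| := le_abs_self _
      _ = |p| * |y| := by rw [abs_mul, sub_zero]
      _ ≤ |p| * b := by gcongr; exact abs_le.2 ⟨by linarith [hy.1], hy.2⟩
  have h3 : min (f (-b)) (f b) ≤ f y :=
    hf.ge_on_segment (left_mem_Icc.2 (by linarith)) (right_mem_Icc.2 (by linarith))
      (by rw [segment_eq_Icc (by linarith)]; exact hy)
  have h5 : -|f (-b)| - |f b| ≤ min (f (-b)) (f b) :=
    le_min (by linarith [neg_abs_le (f (-b)), abs_nonneg (f b)])
      (by linarith [neg_abs_le (f b), abs_nonneg (f (-b))])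
  have h4 := le_abs_self (f 0)
  have h6 := abs_nonneg (f b)
  have h7 := abs_nonneg (f (-b))
  have h8 := abs_nonneg (f 0)
  have h9 : 0 ≤ |p| * b := by positivity
  rw [abs_le]; constructor <;> linarith

/-- The slope of the line through the point `m` of the axis `y = 0` that supports the graph of `f`
over `(0, b)` from above, namely `sup {(f y - m) / y : 0 < y < b}`. -/
noncomputable def tangentSlope (f : ℝ → ℝ) (b m : ℝ) : ℝ :=
  sSup ((fun y => (f y - m) / y) '' Ioo 0 b)

theorem mem_upperBounds_slopes {f : ℝ → ℝ} {b m p : ℝ}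
    (hp : ∀ z ∈ Icc 0 b, f z ≤ f 0 + p * z) (hm : f 0 ≤ m) :
    p ∈ upperBounds ((fun y => (f y - m) / y) '' Ioo 0 b) := by
  rintro _ ⟨y, hy, rfl⟩
  have := hp y ⟨hy.1.le, hy.2.le⟩
  simp only
  rw [div_le_iff₀ hy.1]
  linarith

theorem tangentSlope_le {f : ℝ → ℝ} {b m p : ℝ} (hb : 0 < b)
    (hp : ∀ z ∈ Icc 0 b, f z ≤ f 0 + p * z) (hm : f 0 ≤ m) : tangentSlope f b m ≤ p :=
  csSup_le ((nonempty_Ioo.2 hb).image _) (mem_upperBounds_slopes hp hm)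

theorem le_tangentSlope_mul {f : ℝ → ℝ} {b m p : ℝ}
    (hp : ∀ z ∈ Icc 0 b, f z ≤ f 0 + p * z) (hm : f 0 ≤ m) {y : ℝ} (hy : y ∈ Ioo 0 b) :
    f y - m ≤ tangentSlope f b m * y := by
  rw [← div_le_iff₀ hy.1]
  exact le_csSup ⟨p, mem_upperBounds_slopes hp hm⟩ (mem_image_of_mem _ hy)

theorem add_nonpos_of_forall_Ioo {A B : ℝ} (h : ∀ l ∈ Ioo (0 : ℝ) 1, A + B * l ≤ 0) :
    A + B ≤ 0 := by
  have hc : Tendsto (fun l => A + B * l) (𝓝[<] (1 : ℝ)) (𝓝 (A + B * 1)) :=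
    ((continuous_const.add (continuous_const.mul continuous_id)).tendsto 1).mono_left
      nhdsWithin_le_nhds
  have := le_of_tendsto hc (by
    filter_upwards [Ioo_mem_nhdsLT (show (0 : ℝ) < 1 by norm_num)] with l hl using h l hl)
  simpa using this

/-- A concave function is lower semicontinuous at an end of its interval, so that the bound defining
`tangentSlope` persists there. -/
theorem le_tangentSlope_mul_Ioc {f : ℝ → ℝ} {b m p : ℝ} (hf : ConcaveOn ℝ (Icc 0 b) f)
    (hp : ∀ z ∈ Icc 0 b, f z ≤ f 0 + p * z) (hm : f 0 ≤ m) {y : ℝ} (hy : y ∈ Ioc 0 b) :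
    f y - m ≤ tangentSlope f b m * y := by
  rcases hy.2.lt_or_eq with h | rfl
  · exact le_tangentSlope_mul hp hm ⟨hy.1, h⟩
  have hb := hy.1
  have := @add_nonpos_of_forall_Ioo (f 0 - m) (f y - f 0 - tangentSlope f y m * y) (by
    intro l hl
    have h1 := le_tangentSlope_mul hp hm (y := l * y)
      ⟨mul_pos hl.1 hb, by nlinarith [hl.2]⟩
    have h2 := hf.2 (right_mem_Icc.2 hb.le) (left_mem_Icc.2 hb.le) hl.1.le (sub_nonneg.2 hl.2.le)
      (by ring)
    simp only [smul_eq_mul, mul_zero, add_zero] at h2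
    nlinarith)
  linarith

theorem exists_tangentSlope_eq {f : ℝ → ℝ} {b m p : ℝ} (hb : 0 < b)
    (hc : ContinuousOn f (Icc 0 b)) (hf : ConcaveOn ℝ (Icc 0 b) f)
    (hp : ∀ z ∈ Icc 0 b, f z ≤ f 0 + p * z) (hm : f 0 < m) :
    ∃ y ∈ Ioc 0 b, f y - m = tangentSlope f b m * y := by
  set P := tangentSlope f b m with hP
  obtain ⟨y, hy, hmax⟩ := isCompact_Icc.exists_isMaxOn (nonempty_Icc.2 hb.le)
    (f := fun y => f y - m - P * y)
    ((hc.sub continuousOn_const).sub (continuousOn_const.mul continuousOn_id))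
  have hmax' : ∀ z ∈ Icc 0 b, f z - m - P * z ≤ f y - m - P * y := fun z hz => hmax hz
  have hle : f y - m - P * y ≤ 0 := by
    rcases hy.1.eq_or_lt with h | h
    · subst h; linarith
    · linarith [le_tangentSlope_mul_Ioc hf hp hm.le ⟨h, hy.2⟩]
  have hge : 0 ≤ f y - m - P * y := by
    by_contra! hlt
    -- otherwise `P` could be lowered by the gap divided by `b`
    have : P ≤ P + (f y - m - P * y) / b := by
      refine csSup_le ((nonempty_Ioo.2 hb).image _) ?_
      rintro _ ⟨z, hz, rfl⟩
      have h1 := hmax' z ⟨hz.1.le, hz.2.le⟩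
      simp only
      rw [div_le_iff₀ hz.1]
      have h2 : (f y - m - P * y) ≤ (f y - m - P * y) / b * z := by
        rw [div_mul_eq_mul_div, le_div_iff₀ hb]
        nlinarith [hz.2]
      nlinarith
    have h3 : (f y - m - P * y) / b < 0 := div_neg_of_neg_of_pos hlt hb
    linarith
  refine ⟨y, ⟨lt_of_le_of_ne hy.1 ?_, hy.2⟩, by linarith⟩
  rintro rfl
  linarith

theorem convexOn_tangentSlope {f : ℝ → ℝ} {b p : ℝ} (hb : 0 < b)
    (hp : ∀ z ∈ Icc 0 b, f z ≤ f 0 + p * z) : ConvexOn ℝ (Ioi (f 0)) (tangentSlope f b) := by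
  refine ⟨convex_Ioi _, fun m hm m' hm' a a' ha ha' haa => ?_⟩
  refine csSup_le ((nonempty_Ioo.2 hb).image _) ?_
  rintro _ ⟨y, hy, rfl⟩
  have h1 := mul_le_mul_of_nonneg_left (le_tangentSlope_mul hp (le_of_lt hm) hy) ha
  have h2 := mul_le_mul_of_nonneg_left (le_tangentSlope_mul hp (le_of_lt hm') hy) ha'
  simp only [smul_eq_mul]
  rw [div_le_iff₀ hy.1]
  have h3 : f y = a * f y + a' * f y := by rw [← add_mul, haa, one_mul]
  nlinarith

theorem tangentSlope_midpoint_le {g β : ℝ → ℝ} {b m p q : ℝ} (hb : 0 < b) (hβ0 : β 0 = 0)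
    (hp : ∀ z ∈ Icc 0 b, g z + β z ≤ g 0 + p * z) (hq : ∀ z ∈ Icc 0 b, g z - β z ≤ g 0 + q * z)
    (hm : g 0 ≤ m) :
    2 * tangentSlope g b m ≤
      tangentSlope (fun y => g y + β y) b m + tangentSlope (fun y => g y - β y) b m := by
  rw [← le_div_iff₀' (by norm_num)]
  refine csSup_le ((nonempty_Ioo.2 hb).image _) ?_
  rintro _ ⟨y, hy, rfl⟩
  have h1 := le_tangentSlope_mul (f := fun y => g y + β y) (m := m) (by simpa [hβ0] using hp)
    (by simpa [hβ0] using hm) hy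
  have h2 := le_tangentSlope_mul (f := fun y => g y - β y) (m := m) (by simpa [hβ0] using hq)
    (by simpa [hβ0] using hm) hy
  simp only
  rw [div_le_iff₀ hy.1]
  linarith

/-- A function whose increments over `[m, m']` are at most `(m' - m) (q m - q m')` is constant: the
bound telescopes over a fine subdivision. -/
theorem eq_of_abs_sub_le_mul {D q : ℝ → ℝ} {a : ℝ}
    (h : ∀ m m', a < m → m < m' → |D m' - D m| ≤ (m' - m) * (q m - q m')) {m m' : ℝ} (hm : a < m)
    (hmm : m < m') : D m = D m' := by
  have key : ∀ (δ : ℝ), 0 < δ → ∀ n : ℕ,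
      |D (m + n * δ) - D m| ≤ δ * (q m - q (m + n * δ)) := by
    intro δ hδ n
    induction n with
    | zero => simp
    | succ n ih =>
      have hn : (0 : ℝ) ≤ n * δ := by positivity
      have h1 := h (m + n * δ) (m + (n + 1 : ℕ) * δ) (by linarith) (by push_cast; linarith)
      have h2 : m + ((n + 1 : ℕ) : ℝ) * δ - (m + n * δ) = δ := by push_cast; ring
      rw [h2] at h1
      calc _ ≤ |D (m + (n + 1 : ℕ) * δ) - D (m + n * δ)| + |D (m + n * δ) - D m| :=
            abs_sub_le _ _ _
        _ ≤ _ := by linarith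
  have key2 : ∀ n : ℕ, |D m' - D m| ≤ (m' - m) * (q m - q m') * (1 / ((n : ℝ) + 1)) := by
    intro n
    have hn : (0 : ℝ) < (n : ℝ) + 1 := by positivity
    have h1 := key ((m' - m) / (n + 1)) (div_pos (by linarith) hn) (n + 1)
    have h2 : m + ((n + 1 : ℕ) : ℝ) * ((m' - m) / (n + 1)) = m' := by
      push_cast; field_simp; ring
    rw [h2] at h1
    calc _ ≤ _ := h1
      _ = _ := by field_simp
  have hlim : Tendsto (fun n : ℕ => (m' - m) * (q m - q m') * (1 / ((n : ℝ) + 1))) atTop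
      (𝓝 ((m' - m) * (q m - q m') * 0)) :=
    tendsto_one_div_add_atTop_nhds_zero_nat.const_mul _
  have := ge_of_tendsto' hlim key2
  rw [mul_zero] at this
  have := abs_nonpos_iff.1 this
  linarith

/-- Equality case of `tangentSlope_midpoint_le`. A contact point `y` of the supporting line of `g`
through `m` is then one for `g ± β`, so the slopes for `g` and `g + β` are convex functions of `m`
with the common subgradient `-1 / y` and differ by a constant `c`. Since `g` is the infimum of its
supporting lines, this gives `β y = c y`. -/
theorem eq_const_mul_of_tangentSlope_midpoint {g β : ℝ → ℝ} {b p q r : ℝ} (hb : 0 < b)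
    (hβ0 : β 0 = 0) (hc : ContinuousOn g (Icc 0 b)) (hg : ConcaveOn ℝ (Icc 0 b) g)
    (hgp : ConcaveOn ℝ (Icc 0 b) (fun y => g y + β y))
    (hgm : ConcaveOn ℝ (Icc 0 b) (fun y => g y - β y))
    (hr : ∀ z ∈ Icc 0 b, g z ≤ g 0 + r * z)
    (hp : ∀ z ∈ Icc 0 b, g z + β z ≤ g 0 + p * z) (hq : ∀ z ∈ Icc 0 b, g z - β z ≤ g 0 + q * z)
    (heq : ∀ m, g 0 < m → 2 * tangentSlope g b m =
      tangentSlope (fun y => g y + β y) b m + tangentSlope (fun y => g y - β y) b m) :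
    ∃ c, ∀ y ∈ Ioo 0 b, β y = c * y := by
  set P := tangentSlope g b with hP
  set Pp := tangentSlope (fun y => g y + β y) b with hPp
  set Pm := tangentSlope (fun y => g y - β y) b with hPm
  have lep : ∀ m, g 0 < m → ∀ y ∈ Ioc 0 b, g y + β y - m ≤ Pp m * y := fun m hm y hy =>
    le_tangentSlope_mul_Ioc hgp (by simpa [hβ0] using hp) (by simpa [hβ0] using hm.le) hy
  have lem : ∀ m, g 0 < m → ∀ y ∈ Ioc 0 b, g y - β y - m ≤ Pm m * y := fun m hm y hy =>
    le_tangentSlope_mul_Ioc hgm (by simpa [hβ0] using hq) (by simpa [hβ0] using hm.le) hy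
  have le0 : ∀ m, g 0 < m → ∀ y ∈ Ioc 0 b, g y - m ≤ P m * y := fun m hm y hy =>
    le_tangentSlope_mul_Ioc hg hr hm.le hy
  have ex : ∀ m, ∃ y, g 0 < m → y ∈ Ioc 0 b ∧ g y - m = P m * y ∧ g y + β y - m = Pp m * y := by
    intro m
    by_cases hm : g 0 < m
    · obtain ⟨y, hy, h⟩ := exists_tangentSlope_eq hb hc hg hr hm
      refine ⟨y, fun _ => ⟨hy, h, ?_⟩⟩
      have h1 := lep m hm y hy
      have h2 := lem m hm y hy
      have h3 := heq m hm
      have h4 : 2 * (P m * y) = Pp m * y + Pm m * y := by rw [← add_mul, ← h3]; ring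
      change g y - m = P m * y at h
      linarith
    · exact ⟨0, fun h => absurd h hm⟩
  choose Y hY using ex
  have hD : ∀ m m', g 0 < m → m < m' →
      |(Pp m' - P m') - (Pp m - P m)| ≤ (m' - m) * ((Y m)⁻¹ - (Y m')⁻¹) := by
    intro m m' hm hmm
    have hm' := hm.trans hmm
    obtain ⟨hy, h1, h2⟩ := hY m hm
    obtain ⟨hy', h1', h2'⟩ := hY m' hm'
    have e1 : P m' ≥ P m - (m' - m) * (Y m)⁻¹ := by
      rw [ge_iff_le, ← mul_le_mul_iff_left₀ hy.1, sub_mul, inv_mul_cancel_right₀ hy.1.ne']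
      linarith [le0 m' hm' _ hy]
    have e2 : Pp m' ≥ Pp m - (m' - m) * (Y m)⁻¹ := by
      rw [ge_iff_le, ← mul_le_mul_iff_left₀ hy.1, sub_mul, inv_mul_cancel_right₀ hy.1.ne']
      linarith [lep m' hm' _ hy]
    have e3 : P m ≥ P m' + (m' - m) * (Y m')⁻¹ := by
      rw [ge_iff_le, ← mul_le_mul_iff_left₀ hy'.1, add_mul, inv_mul_cancel_right₀ hy'.1.ne']
      linarith [le0 m hm _ hy']
    have e4 : Pp m ≥ Pp m' + (m' - m) * (Y m')⁻¹ := by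
      rw [ge_iff_le, ← mul_le_mul_iff_left₀ hy'.1, add_mul, inv_mul_cancel_right₀ hy'.1.ne']
      linarith [lep m hm _ hy']
    rw [abs_le]
    constructor <;> linarith
  set c := Pp (g 0 + 1) - P (g 0 + 1) with hcdef
  have hconst : ∀ m, g 0 < m → Pp m = P m + c := by
    intro m hm
    have : Pp m - P m = c := by
      rcases lt_trichotomy m (g 0 + 1) with h | h | h
      · exact eq_of_abs_sub_le_mul (D := fun m => Pp m - P m) hD hm h
      · rw [h]
      · exact (eq_of_abs_sub_le_mul (D := fun m => Pp m - P m) hD (by linarith) h).symm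
    linarith
  refine ⟨c, fun y hy => ?_⟩
  obtain ⟨s, hs⟩ := exists_supergradient hg (y := y) (by rw [interior_Icc]; exact hy)
  have hs0 := hs 0 (left_mem_Icc.2 hb.le)
  have main : ∀ ε > 0, g y + β y ≤ g y + c * y + ε ∧ g y - β y ≤ g y - c * y + ε := by
    intro ε hε
    have hm : g 0 < g y - s * y + ε := by linarith
    have hPle : P (g y - s * y + ε) ≤ s := by
      refine csSup_le ((nonempty_Ioo.2 hb).image _) ?_
      rintro _ ⟨z, hz, rfl⟩
      simp only
      rw [div_le_iff₀ hz.1]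
      linarith [hs z ⟨hz.1.le, hz.2.le⟩]
    have hPy : P (g y - s * y + ε) * y ≤ s * y := mul_le_mul_of_nonneg_right hPle hy.1.le
    have h1 := lep _ hm y ⟨hy.1, hy.2.le⟩
    have h2 := lem _ hm y ⟨hy.1, hy.2.le⟩
    have h3 := heq _ hm
    have h4 := hconst _ hm
    have h5 : Pm (g y - s * y + ε) = P (g y - s * y + ε) - c := by linarith
    rw [h4] at h1
    rw [h5] at h2
    constructor <;> nlinarith
  refine le_antisymm ?_ ?_
  · refine le_of_forall_pos_le_add fun ε hε => ?_
    linarith [(main ε hε).1]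
  · refine le_of_forall_pos_le_add fun ε hε => ?_
    linarith [(main ε hε).2]

/-! ### Support functions and convergence in `H¹` -/

theorem inner_angle (x : EuclideanSpace ℝ (Fin 2)) (θ : ℝ) :
    inner ℝ x !₂[Real.cos θ, Real.sin θ] = x 0 * Real.cos θ + x 1 * Real.sin θ := by
  simp [PiLp.inner_apply, Fin.sum_univ_two, mul_comm]

theorem abs_coord_le_norm (x : EuclideanSpace ℝ (Fin 2)) (i : Fin 2) : |x i| ≤ ‖x‖ :=
  PiLp.norm_apply_le x i

theorem inner_angle_le {R : ℝ} {x : EuclideanSpace ℝ (Fin 2)} (hx : ‖x‖ ≤ R) (θ : ℝ) :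
    inner ℝ x !₂[Real.cos θ, Real.sin θ] ≤ 2 * R := by
  rw [inner_angle]
  have h0 := (abs_coord_le_norm x 0).trans hx
  have h1 := (abs_coord_le_norm x 1).trans hx
  have h2 : x 0 * Real.cos θ ≤ R := by
    calc _ ≤ |x 0 * Real.cos θ| := le_abs_self _
      _ = |x 0| * |Real.cos θ| := abs_mul _ _
      _ ≤ |x 0| * 1 := by gcongr; exact Real.abs_cos_le_one θ
      _ ≤ R := by linarith
  have h3 : x 1 * Real.sin θ ≤ R := by
    calc _ ≤ |x 1 * Real.sin θ| := le_abs_self _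
      _ = |x 1| * |Real.sin θ| := abs_mul _ _
      _ ≤ |x 1| * 1 := by gcongr; exact Real.abs_sin_le_one θ
      _ ≤ R := by linarith
  linarith

section SupportFun

variable {K : Set (EuclideanSpace ℝ (Fin 2))} {R : ℝ}

theorem le_supportFun (hK : ∀ x ∈ K, ‖x‖ ≤ R) {x : EuclideanSpace ℝ (Fin 2)} (hx : x ∈ K) (θ : ℝ) :
    inner ℝ x !₂[Real.cos θ, Real.sin θ] ≤ supportFun K θ :=
  le_csSup ⟨2 * R, by rintro _ ⟨y, hy, rfl⟩; exact inner_angle_le (hK y hy) θ⟩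
    (mem_image_of_mem _ hx)

theorem supportFun_le (hne : K.Nonempty) {θ c : ℝ}
    (h : ∀ x ∈ K, inner ℝ x !₂[Real.cos θ, Real.sin θ] ≤ c) : supportFun K θ ≤ c :=
  csSup_le (hne.image _) (by rintro _ ⟨y, hy, rfl⟩; exact h y hy)

theorem supportFun_periodic : Function.Periodic (supportFun K) (2 * Real.pi) := by
  intro θ
  simp [supportFun]

theorem supportFun_lipschitz (hne : K.Nonempty) (hK : ∀ x ∈ K, ‖x‖ ≤ R) :
    LipschitzWith (2 * R).toNNReal (supportFun K) := by
  obtain ⟨x₀, hx₀⟩ := hne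
  have hR : 0 ≤ R := (norm_nonneg _).trans (hK x₀ hx₀)
  refine LipschitzWith.of_le_add_mul _ fun θ θ' => supportFun_le ⟨x₀, hx₀⟩ fun x hx => ?_
  have h := le_supportFun hK hx θ'
  rw [inner_angle] at h ⊢
  rw [Real.coe_toNNReal _ (by positivity), Real.dist_eq]
  have hc : |Real.cos θ - Real.cos θ'| ≤ |θ - θ'| := Real.abs_cos_sub_cos_le θ θ'
  have hs : |Real.sin θ - Real.sin θ'| ≤ |θ - θ'| := Real.abs_sin_sub_sin_le θ θ'
  have h2 : x 0 * (Real.cos θ - Real.cos θ') ≤ R * |θ - θ'| := by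
    refine (le_abs_self _).trans ?_
    rw [abs_mul]
    exact mul_le_mul ((abs_coord_le_norm x 0).trans (hK x hx)) hc (abs_nonneg _) hR
  have h3 : x 1 * (Real.sin θ - Real.sin θ') ≤ R * |θ - θ'| := by
    refine (le_abs_self _).trans ?_
    rw [abs_mul]
    exact mul_le_mul ((abs_coord_le_norm x 1).trans (hK x hx)) hs (abs_nonneg _) hR
  linarith

theorem convexOn_inner_angle {x : EuclideanSpace ℝ (Fin 2)} (hx : ‖x‖ ≤ R) :
    ConvexOn ℝ univ (fun θ => x 0 * Real.cos θ + x 1 * Real.sin θ + R * θ ^ 2) := by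
  have d1 : ∀ θ, HasDerivAt (fun θ => x 0 * Real.cos θ + x 1 * Real.sin θ + R * θ ^ 2)
      (x 0 * (-Real.sin θ) + x 1 * Real.cos θ + R * (2 * θ)) θ := fun θ => by
    simpa using (((Real.hasDerivAt_cos θ).const_mul (x 0)).fun_add
      ((Real.hasDerivAt_sin θ).const_mul (x 1))).fun_add ((hasDerivAt_pow 2 θ).const_mul R)
  have e1 : deriv (fun θ => x 0 * Real.cos θ + x 1 * Real.sin θ + R * θ ^ 2) =
      fun θ => x 0 * (-Real.sin θ) + x 1 * Real.cos θ + R * (2 * θ) :=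
    funext fun θ => (d1 θ).deriv
  have d2 : ∀ θ, HasDerivAt (fun θ => x 0 * (-Real.sin θ) + x 1 * Real.cos θ + R * (2 * θ))
      (x 0 * (-Real.cos θ) + x 1 * (-Real.sin θ) + R * (2 * 1)) θ := fun θ =>
    (((Real.hasDerivAt_sin θ).neg.const_mul (x 0)).add
      ((Real.hasDerivAt_cos θ).const_mul (x 1))).add
      (((hasDerivAt_id θ).const_mul 2).const_mul R)
  refine convexOn_univ_of_deriv2_nonneg (fun θ => (d1 θ).differentiableAt) ?_ fun θ => ?_
  · rw [e1]; exact fun θ => (d2 θ).differentiableAt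
  · rw [Function.iterate_succ, Function.iterate_one, Function.comp_apply, e1, (d2 θ).deriv]
    have := inner_angle_le hx θ
    rw [inner_angle] at this
    linarith

/-- A support function is semiconvex, being a supremum of sinusoids of bounded amplitude. -/
theorem supportFun_semiconvex (hne : K.Nonempty) (hK : ∀ x ∈ K, ‖x‖ ≤ R) :
    ConvexOn ℝ univ (fun θ => supportFun K θ + R * θ ^ 2) := by
  refine ⟨convex_univ, fun θ _ θ' _ a a' ha ha' haa => ?_⟩
  have : supportFun K (a • θ + a' • θ') ≤
      a • (supportFun K θ + R * θ ^ 2) + a' • (supportFun K θ' + R * θ' ^ 2) -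
        R * (a • θ + a' • θ') ^ 2 := by
    refine supportFun_le hne fun x hx => ?_
    have h1 := (convexOn_inner_angle (hK x hx)).2 (mem_univ θ) (mem_univ θ') ha ha' haa
    have h2 := le_supportFun hK hx θ
    have h3 := le_supportFun hK hx θ'
    rw [inner_angle] at h2 h3 ⊢
    have h4 := mul_le_mul_of_nonneg_left h2 ha
    have h5 := mul_le_mul_of_nonneg_left h3 ha'
    simp only [smul_eq_mul] at h1 ⊢
    linarith
  linarith

end SupportFun

/-- Derivatives of semiconvex functions converge wherever they exist, if the functions converge. -/
theorem tendsto_deriv_of_semiconvex {u : ℕ → ℝ → ℝ} {v : ℝ → ℝ} {C θ : ℝ}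
    (hu : ∀ n, ConvexOn ℝ univ (fun θ => u n θ + C * θ ^ 2))
    (hlim : ∀ θ, Tendsto (fun n => u n θ) atTop (𝓝 (v θ)))
    (hd : ∀ n, DifferentiableAt ℝ (u n) θ) (hv : DifferentiableAt ℝ v θ) :
    Tendsto (fun n => deriv (u n) θ) atTop (𝓝 (deriv v θ)) := by
  have hd' : ∀ n, HasDerivAt (fun θ => u n θ + C * θ ^ 2) (deriv (u n) θ + C * (2 * θ)) θ := by
    intro n
    simpa using (hd n).hasDerivAt.fun_add ((hasDerivAt_pow 2 θ).const_mul C)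
  have key : ∀ n δ, deriv (u n) θ * δ ≤ u n (θ + δ) - u n θ + C * δ ^ 2 := by
    intro n δ
    rcases lt_trichotomy δ 0 with h | rfl | h
    · have := (hu n).slope_le_of_hasDerivAt (mem_univ (θ + δ)) (mem_univ θ) (by linarith) (hd' n)
      rw [slope_def_field, div_le_iff₀ (by linarith)] at this
      nlinarith
    · simp
    · have := (hu n).le_slope_of_hasDerivAt (mem_univ θ) (mem_univ (θ + δ)) (by linarith) (hd' n)
      rw [slope_def_field, le_div_iff₀ (by linarith)] at this
      nlinarith
  rw [Metric.tendsto_atTop]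
  intro ε hε
  have hsl : ∀ᶠ δ in 𝓝 (0 : ℝ), |v (θ + δ) - v θ - deriv v θ * δ| ≤ ε / 4 * |δ| := by
    have := (hasDerivAt_iff_isLittleO_nhds_zero.1 hv.hasDerivAt).bound
      (show (0 : ℝ) < ε / 4 by positivity)
    filter_upwards [this] with δ h
    simpa [mul_comm] using h
  obtain ⟨r, hr, hsl⟩ := Metric.eventually_nhds_iff.1 hsl
  obtain ⟨δ, hδ, hδr, hδC⟩ : ∃ δ > 0, δ < r ∧ C * δ ≤ ε / 4 := by
    refine ⟨min (r / 2) (ε / 4 / (|C| + 1)), by positivity, ?_, ?_⟩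
    · exact (min_le_left _ _).trans_lt (by linarith)
    · have h1 : 0 < |C| + 1 := by positivity
      calc C * min (r / 2) (ε / 4 / (|C| + 1)) ≤ (|C| + 1) * (ε / 4 / (|C| + 1)) := by
            apply mul_le_mul _ (min_le_right _ _) (by positivity) h1.le
            linarith [le_abs_self C]
        _ = ε / 4 := by field_simp
  have e1 := hsl (y := δ) (by simpa [abs_of_pos hδ] using hδr)
  have e2 := hsl (y := -δ) (by simpa [abs_of_pos hδ] using hδr)
  rw [abs_neg, abs_of_pos hδ, abs_le] at e2
  rw [abs_of_pos hδ, abs_le] at e1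
  have hεδ : 0 < ε / 8 * δ := by positivity
  obtain ⟨N₁, hN₁⟩ := Metric.tendsto_atTop.1 (hlim (θ + δ)) _ hεδ
  obtain ⟨N₂, hN₂⟩ := Metric.tendsto_atTop.1 (hlim (θ + -δ)) _ hεδ
  obtain ⟨N₃, hN₃⟩ := Metric.tendsto_atTop.1 (hlim θ) _ hεδ
  refine ⟨max N₁ (max N₂ N₃), fun n hn => ?_⟩
  have a1 := hN₁ n ((le_max_left _ _).trans hn)
  have a2 := hN₂ n (((le_max_left _ _).trans (le_max_right _ _)).trans hn)
  have a3 := hN₃ n (((le_max_right _ _).trans (le_max_right _ _)).trans hn)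
  rw [Real.dist_eq, abs_lt] at a1 a2 a3
  have k1 := key n δ
  have k2 := key n (-δ)
  rw [Real.dist_eq, abs_lt]
  have hC2 : C * δ ^ 2 ≤ ε / 4 * δ := by nlinarith
  constructor
  · nlinarith
  · nlinarith

theorem isFiniteMeasure_circleMeasure : IsFiniteMeasure circleMeasure := by
  unfold circleMeasure; infer_instance

/-- The weak derivative of a Lipschitz periodic function is its almost everywhere derivative. -/
theorem hasH1Deriv_deriv {f : ℝ → ℝ} {C : NNReal} (hf : LipschitzWith C f)
    (hp : Function.Periodic f (2 * Real.pi)) : HasH1Deriv f (deriv f) := by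
  have := isFiniteMeasure_circleMeasure
  have h2π : (0 : ℝ) ≤ 2 * Real.pi := by positivity
  refine ⟨?_, ?_, ?_⟩
  · obtain ⟨B, hB⟩ := (isCompact_Icc (a := (0 : ℝ)) (b := 2 * Real.pi)).exists_bound_of_continuousOn
      hf.continuous.continuousOn
    refine MemLp.of_bound hf.continuous.aestronglyMeasurable B ?_
    exact (ae_restrict_iff' measurableSet_Ioc).2 (ae_of_all _ fun θ h => hB θ ⟨h.1.le, h.2⟩)
  · exact MemLp.of_bound (measurable_deriv f).aestronglyMeasurable C
      (ae_of_all _ fun θ => norm_deriv_le_of_lipschitz hf)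
  · intro φ hφ hφp
    have hfa : AbsolutelyContinuousOnInterval f 0 (2 * Real.pi) :=
      (hf.lipschitzOnWith (s := uIcc 0 (2 * Real.pi))).absolutelyContinuousOnInterval
    have hφa : AbsolutelyContinuousOnInterval φ 0 (2 * Real.pi) :=
      (hφ.of_le (by simp)).contDiffOn.absolutelyContinuousOnInterval
    have h := hfa.integral_mul_deriv_eq_deriv_mul hφa
    rw [intervalIntegral.integral_of_le h2π, intervalIntegral.integral_of_le h2π] at h
    have e1 : f (2 * Real.pi) = f 0 := by simpa using hp 0
    have e2 : φ (2 * Real.pi) = φ 0 := by simpa using hφp 0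
    rw [e1, e2, sub_self, zero_sub] at h
    exact h

theorem h1Norm_le {f : ℝ → ℝ} {C : NNReal} (hf : LipschitzWith C f)
    (hp : Function.Periodic f (2 * Real.pi)) :
    h1Norm f ≤ ENNReal.ofReal
      (Real.sqrt ((∫ θ, f θ ^ 2 ∂circleMeasure) + ∫ θ, deriv f θ ^ 2 ∂circleMeasure)) :=
  iInf₂_le _ (hasH1Deriv_deriv hf hp)

/-- Uniform convergence of uniformly bounded bodies implies `H¹` convergence of their support
functions: by semiconvexity the derivatives converge almost everywhere, and they are bounded. -/
theorem eventually_h1Norm_le {K : Set (EuclideanSpace ℝ (Fin 2))}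
    {L : ℕ → Set (EuclideanSpace ℝ (Fin 2))} {R : ℝ} (hKne : K.Nonempty) (hK : ∀ x ∈ K, ‖x‖ ≤ R)
    (hLne : ∀ n, (L n).Nonempty) (hL : ∀ n, ∀ x ∈ L n, ‖x‖ ≤ R)
    (hlim : ∀ θ, Tendsto (fun n => supportFun (L n) θ) atTop (𝓝 (supportFun K θ)))
    {ε : ℝ} (hε : 0 < ε) :
    ∀ᶠ n in atTop, h1Norm (fun θ => supportFun (L n) θ - supportFun K θ) ≤ ENNReal.ofReal ε := by
  have := isFiniteMeasure_circleMeasure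
  have hKl := supportFun_lipschitz hKne hK
  have hLl := fun n => supportFun_lipschitz (hLne n) (hL n)
  have hl : ∀ n, LipschitzWith ((2 * R).toNNReal + (2 * R).toNNReal)
      (fun θ => supportFun (L n) θ - supportFun K θ) := fun n => (hLl n).sub hKl
  have hR : 0 ≤ R := by
    obtain ⟨x, hx⟩ := hKne
    exact (norm_nonneg x).trans (hK x hx)
  have hb : ∀ {M : Set (EuclideanSpace ℝ (Fin 2))}, M.Nonempty → (∀ x ∈ M, ‖x‖ ≤ R) →
      ∀ θ, |supportFun M θ| ≤ 2 * R := by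
    intro M hM hMR θ
    refine abs_le.2 ⟨?_, supportFun_le hM fun x hx => inner_angle_le (hMR x hx) θ⟩
    obtain ⟨x, hx⟩ := hM
    refine le_trans ?_ (le_supportFun hMR hx θ)
    have := inner_angle_le (x := -x) (by simpa using hMR x hx) θ
    rw [inner_neg_left] at this
    linarith
  have h1 : Tendsto (fun n => ∫ θ, (supportFun (L n) θ - supportFun K θ) ^ 2 ∂circleMeasure) atTop
      (𝓝 (∫ _, (0 : ℝ) ∂circleMeasure)) := by
    refine tendsto_integral_of_dominated_convergence (fun _ => (4 * R) ^ 2)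
      (fun n => ((hl n).continuous.pow 2).aestronglyMeasurable) (integrable_const _) ?_ ?_
    · refine fun n => ae_of_all _ fun θ => ?_
      have a1 := abs_le.1 (hb (hLne n) (hL n) θ)
      have a2 := abs_le.1 (hb hKne hK θ)
      rw [Real.norm_eq_abs, abs_pow]
      gcongr
      rw [abs_le]; constructor <;> linarith
    · refine ae_of_all _ fun θ => ?_
      have := ((hlim θ).sub_const (supportFun K θ)).pow 2
      simpa using this
  have hae : ∀ᵐ θ ∂circleMeasure, DifferentiableAt ℝ (supportFun K) θ ∧
      ∀ n, DifferentiableAt ℝ (supportFun (L n)) θ :=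
    ae_restrict_of_ae (hKl.ae_differentiableAt_real.and
      (ae_all_iff.2 fun n => (hLl n).ae_differentiableAt_real))
  have h2 : Tendsto (fun n => ∫ θ, deriv (fun θ => supportFun (L n) θ - supportFun K θ) θ ^ 2
      ∂circleMeasure) atTop (𝓝 (∫ _, (0 : ℝ) ∂circleMeasure)) := by
    refine tendsto_integral_of_dominated_convergence
      (fun _ => (((2 * R).toNNReal + (2 * R).toNNReal : NNReal) : ℝ) ^ 2)
      (fun n => ((measurable_deriv _).pow_const 2).aestronglyMeasurable) (integrable_const _) ?_ ?_
    · refine fun n => ae_of_all _ fun θ => ?_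
      rw [norm_pow]
      gcongr
      exact norm_deriv_le_of_lipschitz (hl n)
    · filter_upwards [hae] with θ hθ
      have h3 := tendsto_deriv_of_semiconvex
        (fun n => supportFun_semiconvex (hLne n) (hL n)) hlim hθ.2 hθ.1
      have h4 := (h3.sub_const (deriv (supportFun K) θ)).pow 2
      have h5 : ∀ n, deriv (fun θ => supportFun (L n) θ - supportFun K θ) θ =
          deriv (supportFun (L n)) θ - deriv (supportFun K) θ := fun n =>
        deriv_fun_sub (hθ.2 n) hθ.1
      simpa [h5] using h4
  have h3 := (h1.add h2).sqrt
  simp only [integral_zero, add_zero, Real.sqrt_zero] at h3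
  filter_upwards [h3.eventually_le_const hε] with n hn
  exact (h1Norm_le (hl n) (supportFun_periodic.sub supportFun_periodic)).trans
    (ENNReal.ofReal_le_ofReal hn)

/-! ### Planar symmetric bodies described by a profile -/

/-- A half-height `b` and a right boundary curve `x = g y`, `|y| ≤ b`, of a centrally symmetric
body; the left boundary is then `x = -g (-y)`. The condition at the ends says that the right
boundary does not cross the left one there; equality means that the top `y = b` is a vertex. -/
structure IsProfile (b : ℝ) (g : ℝ → ℝ) : Prop where
  height_pos : 0 < b
  concave : ConcaveOn ℝ (Icc (-b) b) g
  zero_pos : 0 < g 0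
  ends : 0 ≤ g b + g (-b)

/-- The open symmetric region of half-height `b` with right boundary `x = g y`. -/
def profileBody (b : ℝ) (g : ℝ → ℝ) : Set (EuclideanSpace ℝ (Fin 2)) :=
  {p | p 1 ∈ Ioo (-b) b ∧ -g (-p 1) < p 0 ∧ p 0 < g (p 1)}

section Profile

variable {b : ℝ} {g : ℝ → ℝ}

theorem neg_mem_Icc_neg {y : ℝ} (hy : y ∈ Icc (-b) b) : -y ∈ Icc (-b) b :=
  ⟨by linarith [hy.2], by linarith [hy.1]⟩

theorem neg_mem_Ioo_neg {y : ℝ} (hy : y ∈ Ioo (-b) b) : -y ∈ Ioo (-b) b :=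
  ⟨by linarith [hy.2], by linarith [hy.1]⟩

theorem concaveOn_comp_neg (hg : ConcaveOn ℝ (Icc (-b) b) g) :
    ConcaveOn ℝ (Icc (-b) b) (fun y => g (-y)) := by
  refine ⟨convex_Icc _ _, fun x hx y hy s t hs ht hst => ?_⟩
  have h := hg.2 (neg_mem_Icc_neg hx) (neg_mem_Icc_neg hy) hs ht hst
  have e : -(s • x + t • y) = s • (-x) + t • (-y) := by simp only [smul_eq_mul]; ring
  simp only [e]
  exact h

theorem IsProfile.zero_mem_Icc (h : IsProfile b g) : (0 : ℝ) ∈ Icc (-b) b := by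
  constructor <;> linarith [h.height_pos]

theorem IsProfile.zero_mem_Ioo (h : IsProfile b g) : (0 : ℝ) ∈ Ioo (-b) b := by
  constructor <;> linarith [h.height_pos]

theorem IsProfile.comp_neg (h : IsProfile b g) : IsProfile b (fun y => g (-y)) where
  height_pos := h.height_pos
  concave := concaveOn_comp_neg h.concave
  zero_pos := by simpa using h.zero_pos
  ends := by have := h.ends; simp only [neg_neg]; linarith

theorem IsProfile.width_pos (h : IsProfile b g) {y : ℝ} (hy : y ∈ Ioo (-b) b) :
    0 < g y + g (-y) := by
  have hb := h.height_pos
  have key : ∀ y ∈ Ico 0 b, 0 < g y + g (-y) := by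
    intro y hy
    have hl : 0 ≤ y / b := div_nonneg hy.1 hb.le
    have hl1 : y / b < 1 := (div_lt_one hb).2 hy.2
    have h1 := h.concave.2 (right_mem_Icc.2 (by linarith)) h.zero_mem_Icc hl
      (sub_nonneg.2 hl1.le) (by ring)
    have h2 := h.concave.2 (left_mem_Icc.2 (by linarith)) h.zero_mem_Icc hl
      (sub_nonneg.2 hl1.le) (by ring)
    have e1 : y / b * b = y := div_mul_cancel₀ _ hb.ne'
    simp only [smul_eq_mul, mul_zero, add_zero, mul_neg, e1] at h1 h2
    have h3 := mul_nonneg hl h.ends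
    have h4 := mul_pos (sub_pos.2 hl1) h.zero_pos
    nlinarith
  rcases le_total 0 y with h0 | h0
  · exact key y ⟨h0, hy.2⟩
  · have := key (-y) ⟨by linarith, by linarith [hy.1]⟩
    rw [neg_neg] at this
    linarith

theorem IsProfile.continuousOn_Ioo (h : IsProfile b g) : ContinuousOn g (Ioo (-b) b) := by
  have := h.concave.continuousOn_interior
  rwa [interior_Icc] at this

theorem IsProfile.zero_mem_body (h : IsProfile b g) : (0 : EuclideanSpace ℝ (Fin 2)) ∈
    profileBody b g := by
  refine ⟨h.zero_mem_Ioo, ?_, ?_⟩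
  · simpa using h.zero_pos
  · simpa using h.zero_pos

theorem norm_le_of_abs_le {p : EuclideanSpace ℝ (Fin 2)} {A B : ℝ} (h0 : |p 0| ≤ A)
    (h1 : |p 1| ≤ B) : ‖p‖ ≤ A + B := by
  have hA := (abs_nonneg _).trans h0
  have hB := (abs_nonneg _).trans h1
  rw [EuclideanSpace.norm_eq, Fin.sum_univ_two]
  refine Real.sqrt_le_iff.2 ⟨by linarith, ?_⟩
  simp only [Real.norm_eq_abs]
  nlinarith [abs_nonneg (p 0), abs_nonneg (p 1), mul_nonneg hA hB]

theorem norm_le_of_mem_profileBody {B : ℝ} (hB : ∀ y ∈ Icc (-b) b, |g y| ≤ B)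
    {p : EuclideanSpace ℝ (Fin 2)} (hp : p ∈ profileBody b g) : ‖p‖ ≤ B + b := by
  obtain ⟨hy, h1, h2⟩ := hp
  have hy' := Ioo_subset_Icc_self hy
  refine norm_le_of_abs_le (abs_le.2 ⟨?_, ?_⟩) (abs_le.2 ⟨hy.1.le, hy.2.le⟩)
  · linarith [(abs_le.1 (hB _ (neg_mem_Icc_neg hy'))).2]
  · linarith [(abs_le.1 (hB _ hy')).2]

theorem IsProfile.isSymmConvexBody (h : IsProfile b g) : IsSymmConvexBody (profileBody b g) where
  nonempty := ⟨0, h.zero_mem_body⟩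
  isOpen := by
    have hc0 : Continuous fun p : EuclideanSpace ℝ (Fin 2) => p 0 := by fun_prop
    have hc1 : Continuous fun p : EuclideanSpace ℝ (Fin 2) => p 1 := by fun_prop
    have hU : IsOpen {p : EuclideanSpace ℝ (Fin 2) | p 1 ∈ Ioo (-b) b} := isOpen_Ioo.preimage hc1
    have e : profileBody b g = {p : EuclideanSpace ℝ (Fin 2) | p 1 ∈ Ioo (-b) b} ∩
        (fun p => (g (p 1) - p 0, p 0 + g (-p 1))) ⁻¹' (Ioi 0 ×ˢ Ioi 0) := by
      ext p
      simp only [profileBody, mem_ofPred_eq, mem_inter_iff, mem_preimage, mem_prod, mem_Ioi, sub_pos]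
      constructor
      · rintro ⟨h1, h2, h3⟩; exact ⟨h1, h3, by linarith⟩
      · rintro ⟨h1, h2, h3⟩; exact ⟨h1, by linarith, h2⟩
    rw [e]
    refine ContinuousOn.isOpen_inter_preimage (ContinuousOn.prodMk ?_ ?_) hU
      (isOpen_Ioi.prod isOpen_Ioi)
    · exact (h.continuousOn_Ioo.comp hc1.continuousOn fun p hp => hp).sub hc0.continuousOn
    · exact hc0.continuousOn.add
        (h.continuousOn_Ioo.comp hc1.neg.continuousOn fun p hp => neg_mem_Ioo_neg hp)
  convex := by
    intro p hp q hq s t hs ht hst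
    obtain ⟨p1, p2, p3⟩ := hp
    obtain ⟨q1, q2, q3⟩ := hq
    have c1 := h.concave.2 (Ioo_subset_Icc_self p1) (Ioo_subset_Icc_self q1) hs ht hst
    have c2 := (concaveOn_comp_neg h.concave).2 (Ioo_subset_Icc_self p1) (Ioo_subset_Icc_self q1)
      hs ht hst
    have c3 := convex_Ioo (-b) b p1 q1 hs ht hst
    have strict : ∀ u v : ℝ, 0 < u → 0 < v → 0 < s * u + t * v := by
      intro u v hu hv
      rcases hs.eq_or_lt with rfl | hs
      · have : t = 1 := by linarith
        subst this; linarith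
      · have := mul_pos hs hu
        have := mul_nonneg ht hv.le
        linarith
    have d1 := strict (g (p 1) - p 0) (g (q 1) - q 0) (by linarith) (by linarith)
    have d2 := strict (p 0 + g (-p 1)) (q 0 + g (-q 1)) (by linarith) (by linarith)
    simp only [smul_eq_mul] at c1 c2 c3
    refine ⟨?_, ?_, ?_⟩ <;>
      simp only [PiLp.add_apply, PiLp.smul_apply, smul_eq_mul]
    · exact c3
    · linarith
    · linarith
  isBounded := by
    obtain ⟨B, hB⟩ := exists_abs_le_of_concaveOn h.height_pos h.concave
    exact isBounded_iff_forall_norm_le.2 ⟨B + b, fun p hp => norm_le_of_mem_profileBody hB hp⟩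
  symm := by
    ext p
    simp only [Set.mem_neg, profileBody, mem_ofPred_eq, PiLp.neg_apply, neg_neg]
    constructor
    · rintro ⟨h1, h2, h3⟩
      refine ⟨by simpa using neg_mem_Ioo_neg h1, by linarith, by linarith⟩
    · rintro ⟨h1, h2, h3⟩
      exact ⟨neg_mem_Ioo_neg h1, by linarith, by linarith⟩

end Profile

/-! ### Areas by slices -/

theorem measurePreserving_pair :
    MeasurePreserving (fun p : ℝ × ℝ => (!₂[p.1, p.2] : EuclideanSpace ℝ (Fin 2))) := by
  have h := (PiLp.volume_preserving_toLp (Fin 2)).comp (volume_preserving_finTwoArrow ℝ).symm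
  exact h

theorem volume_eq_lintegral_fst {A : Set (EuclideanSpace ℝ (Fin 2))} (hA : MeasurableSet A) :
    volume A = ∫⁻ s, volume {t : ℝ | !₂[s, t] ∈ A} := by
  rw [← measurePreserving_pair.measure_preimage hA.nullMeasurableSet, Measure.volume_eq_prod,
    Measure.prod_apply (measurePreserving_pair.measurable hA)]
  rfl

theorem measurable_volume_fst {A : Set (EuclideanSpace ℝ (Fin 2))} (hA : MeasurableSet A) :
    Measurable fun s : ℝ => volume {t : ℝ | !₂[s, t] ∈ A} :=
  measurable_measure_prodMk_left (measurePreserving_pair.measurable hA)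

theorem volume_eq_lintegral_snd {A : Set (EuclideanSpace ℝ (Fin 2))} (hA : MeasurableSet A) :
    volume A = ∫⁻ t, volume {s : ℝ | !₂[s, t] ∈ A} := by
  rw [← measurePreserving_pair.measure_preimage hA.nullMeasurableSet, Measure.volume_eq_prod,
    Measure.prod_apply_symm (measurePreserving_pair.measurable hA)]
  rfl

theorem IsProfile.volume_body {b : ℝ} {g : ℝ → ℝ} (h : IsProfile b g) :
    volume (profileBody b g) = ∫⁻ y in Ioo (-b) b, ENNReal.ofReal (g y + g (-y)) := by
  rw [volume_eq_lintegral_snd h.isSymmConvexBody.isOpen.measurableSet,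
    ← lintegral_indicator measurableSet_Ioo]
  congr 1
  ext y
  by_cases hy : y ∈ Ioo (-b) b
  · have : {s : ℝ | !₂[s, y] ∈ profileBody b g} = Ioo (-g (-y)) (g y) := by
      ext s
      simp only [profileBody, mem_ofPred_eq]
      exact ⟨fun hs => hs.2, fun hs => ⟨hy, hs⟩⟩
    rw [this, indicator_of_mem hy, Real.volume_Ioo, sub_neg_eq_add]
  · have : {s : ℝ | !₂[s, y] ∈ profileBody b g} = ∅ := by
      ext s
      simp only [profileBody, mem_ofPred_eq, mem_empty_iff_false, iff_false]
      exact fun hs => hy hs.1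
    rw [this, indicator_of_notMem hy, measure_empty]

/-! ### The polar body -/

theorem isClosed_polarDual {K : Set (EuclideanSpace ℝ (Fin 2))} (hK : IsOpen K) :
    IsClosed (polarDual K) := by
  have : polarDual K = ⋂ x ∈ K, {ξ | inner ℝ x ξ ≤ 1} := by
    ext ξ
    simp only [polarDual, mem_ofPred_eq, mem_iInter]
    refine ⟨fun h x hx => (h x hx).le, fun h x hx => (h x hx).lt_of_ne fun h1 => ?_⟩
    -- the linear form is not bounded by its value at an interior point
    have hc : Tendsto (fun s : ℝ => s • x) (𝓝[>] 1) (𝓝 x) := by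
      have : Continuous fun s : ℝ => s • x := by fun_prop
      simpa using (this.tendsto 1).mono_left nhdsWithin_le_nhds
    obtain ⟨s, hs, hs1⟩ := ((hc.eventually (hK.mem_nhds hx)).and self_mem_nhdsWithin).exists
    have := h _ hs
    rw [real_inner_smul_left, h1] at this
    have hs2 : 1 < s := hs1
    linarith
  rw [this]
  exact isClosed_biInter fun x _ => isClosed_le (by fun_prop) continuous_const

theorem volume_polarDual_ne_top {K : Set (EuclideanSpace ℝ (Fin 2))} (hK : IsOpen K)
    (h0 : 0 ∈ K) : volume (polarDual K) ≠ ⊤ := by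
  obtain ⟨r, hr, hball⟩ := Metric.isOpen_iff.1 hK 0 h0
  refine ((measure_mono ?_).trans_lt (measure_closedBall_lt_top (x := 0) (r := 2 / r))).ne
  intro ξ hξ
  rw [mem_closedBall_zero_iff]
  by_contra! hlt
  have hpos : 0 < ‖ξ‖ := lt_trans (by positivity) hlt
  have := hξ ((r / 2 / ‖ξ‖) • ξ) (hball (by
    rw [mem_ball_zero_iff, norm_smul, Real.norm_of_nonneg (by positivity),
      div_mul_cancel₀ _ hpos.ne']
    linarith))
  rw [real_inner_smul_left, real_inner_self_eq_norm_sq] at this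
  have e : r / 2 / ‖ξ‖ * ‖ξ‖ ^ 2 = r / 2 * ‖ξ‖ := by field_simp
  rw [e] at this
  rw [div_lt_iff₀ hr] at hlt
  linarith

theorem volume_polarDual_ne_zero {K : Set (EuclideanSpace ℝ (Fin 2))}
    (hK : Bornology.IsBounded K) : volume (polarDual K) ≠ 0 := by
  obtain ⟨R, hR0, hR⟩ := hK.exists_pos_norm_le
  refine ((Metric.measure_ball_pos volume 0 (show 0 < 1 / R by positivity)).trans_le
    (measure_mono ?_)).ne'
  intro ξ hξ x hx
  rw [mem_ball_zero_iff, lt_div_iff₀ hR0] at hξ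
  calc inner ℝ x ξ ≤ ‖x‖ * ‖ξ‖ := real_inner_le_norm x ξ
    _ ≤ R * ‖ξ‖ := by gcongr; exact hR x hx
    _ < 1 := by linarith

theorem volume_polarDual_slice_neg {K : Set (EuclideanSpace ℝ (Fin 2))} (hK : -K = K) (s : ℝ) :
    volume {t : ℝ | !₂[-s, t] ∈ polarDual K} = volume {t : ℝ | !₂[s, t] ∈ polarDual K} := by
  have key : ∀ ξ : EuclideanSpace ℝ (Fin 2), -ξ ∈ polarDual K ↔ ξ ∈ polarDual K := by
    have : ∀ ξ : EuclideanSpace ℝ (Fin 2), ξ ∈ polarDual K → -ξ ∈ polarDual K := by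
      intro ξ hξ x hx
      rw [← hK] at hx
      have := hξ _ hx
      rwa [inner_neg_left, ← inner_neg_right] at this
    exact fun ξ => ⟨fun h => by simpa using this _ h, this ξ⟩
  have e : {t : ℝ | !₂[-s, t] ∈ polarDual K} = -{t : ℝ | !₂[s, t] ∈ polarDual K} := by
    ext t
    rw [Set.mem_neg, mem_ofPred_eq, mem_ofPred_eq, ← key]
    have : -(!₂[-s, t] : EuclideanSpace ℝ (Fin 2)) = !₂[s, -t] := by
      ext i; fin_cases i <;> simp
    rw [this]
  rw [e, Measure.measure_neg]

section Slices

variable {b : ℝ} {g : ℝ → ℝ}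

theorem IsProfile.exists_slope (h : IsProfile b g) :
    ∃ p, (∀ z ∈ Icc 0 b, g z ≤ g 0 + p * z) ∧ ∀ z ∈ Icc 0 b, g (-z) ≤ g (-0) + -p * z := by
  obtain ⟨p, hp⟩ := exists_supergradient h.concave (y := 0)
    (by rw [interior_Icc]; exact h.zero_mem_Ioo)
  have hb := h.height_pos
  refine ⟨p, fun z hz => ?_, fun z hz => ?_⟩
  · have := hp z ⟨by linarith [hz.1], hz.2⟩
    simpa using this
  · have := hp (-z) ⟨by linarith [hz.2], by linarith [hz.1]⟩
    simp only [neg_zero]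
    linarith

/-- The signed length of the slice of the polar body at abscissa `s > 0`, see
`IsProfile.volume_polarDual_slice`. -/
noncomputable def polarWidth (b : ℝ) (g : ℝ → ℝ) (s : ℝ) : ℝ :=
  -s * (tangentSlope g b s⁻¹ + tangentSlope (fun y => g (-y)) b s⁻¹)

theorem IsProfile.le_inv (h : IsProfile b g) {s : ℝ} (hs1 : s ≤ (g 0)⁻¹) (hs : 0 < s) :
    g 0 ≤ s⁻¹ :=
  (le_inv_comm₀ hs h.zero_pos).1 hs1

theorem IsProfile.polarWidth_nonneg (h : IsProfile b g) {s : ℝ} (hs : 0 < s)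
    (hs1 : s ≤ (g 0)⁻¹) : 0 ≤ polarWidth b g s := by
  obtain ⟨p, hp, hp'⟩ := h.exists_slope
  have hm := h.le_inv hs1 hs
  have h1 := tangentSlope_le h.height_pos hp hm
  have h2 := tangentSlope_le (f := fun y => g (-y)) h.height_pos hp' (by simpa using hm)
  unfold polarWidth
  nlinarith

theorem IsProfile.mem_polarDual_slice (h : IsProfile b g) {s t : ℝ} (hs : 0 < s) :
    !₂[s, t] ∈ polarDual (profileBody b g) ↔ ∀ y ∈ Ioo (-b) b, s * g y + t * y ≤ 1 := by
  simp only [polarDual, profileBody, mem_ofPred_eq, PiLp.inner_apply, Fin.sum_univ_two]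
  constructor
  · intro H y hy
    by_contra! hlt
    have hw := h.width_pos hy
    -- a point of the body at height `y` close to the right boundary
    set x := max ((1 - t * y) / s) ((g y - g (-y)) / 2) with hx
    have hx1 : x < g y := max_lt (by rw [div_lt_iff₀ hs]; linarith) (by linarith)
    have hx2 : -g (-y) < x := lt_of_lt_of_le (by linarith) (le_max_right _ _)
    have h3 := H !₂[x, y] ⟨hy, hx2, hx1⟩
    have h4 : (1 - t * y) / s ≤ x := le_max_left _ _
    rw [div_le_iff₀ hs] at h4
    simp at h3
    linarith
  · rintro H x ⟨hy, h1, h2⟩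
    have := H _ hy
    have h3 := mul_lt_mul_of_pos_left h2 hs
    simp
    linarith

theorem IsProfile.volume_polarDual_slice_of_lt (h : IsProfile b g) {s : ℝ} (hs : 0 < s)
    (hs1 : (g 0)⁻¹ < s) : volume {t : ℝ | !₂[s, t] ∈ polarDual (profileBody b g)} = 0 := by
  have : {t : ℝ | !₂[s, t] ∈ polarDual (profileBody b g)} = ∅ := by
    ext t
    rw [mem_ofPred_eq, h.mem_polarDual_slice hs, mem_empty_iff_false, iff_false]
    intro H
    have h1 := H 0 h.zero_mem_Ioo
    rw [inv_lt_iff_one_lt_mul₀ h.zero_pos] at hs1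
    linarith
  rw [this, measure_empty]

theorem IsProfile.volume_polarDual_slice (h : IsProfile b g) {s : ℝ} (hs : 0 < s)
    (hs1 : s ≤ (g 0)⁻¹) : volume {t : ℝ | !₂[s, t] ∈ polarDual (profileBody b g)} =
      ENNReal.ofReal (polarWidth b g s) := by
  obtain ⟨p, hp, hp'⟩ := h.exists_slope
  have hb := h.height_pos
  have hm := h.le_inv hs1 hs
  have hm' : (fun y => g (-y)) 0 ≤ s⁻¹ := by simpa using hm
  have e : {t : ℝ | !₂[s, t] ∈ polarDual (profileBody b g)} =
      Icc (s * tangentSlope (fun y => g (-y)) b s⁻¹) (-(s * tangentSlope g b s⁻¹)) := by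
    ext t
    rw [mem_ofPred_eq, h.mem_polarDual_slice hs, mem_Icc]
    constructor
    · intro H
      constructor
      · rw [← le_div_iff₀' hs]
        refine csSup_le ((nonempty_Ioo.2 hb).image _) ?_
        rintro _ ⟨y, hy, rfl⟩
        have := H (-y) ⟨by linarith [hy.2], by linarith [hy.1]⟩
        simp only
        rw [div_le_div_iff₀ hy.1 hs, sub_mul, inv_mul_cancel₀ hs.ne']
        linarith
      · rw [le_neg, ← le_div_iff₀' hs]
        refine csSup_le ((nonempty_Ioo.2 hb).image _) ?_
        rintro _ ⟨y, hy, rfl⟩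
        have := H y ⟨by linarith [hy.1], hy.2⟩
        simp only
        rw [div_le_div_iff₀ hy.1 hs, sub_mul, inv_mul_cancel₀ hs.ne']
        linarith
    · rintro ⟨h1, h2⟩ y hy
      rcases lt_trichotomy y 0 with hy0 | rfl | hy0
      · have h3 := le_tangentSlope_mul (f := fun y => g (-y)) hp' hm' (y := -y)
          ⟨by linarith, by linarith [hy.1]⟩
        have h4 := mul_le_mul_of_nonneg_left h3 hs.le
        rw [mul_sub, mul_inv_cancel₀ hs.ne', neg_neg] at h4
        nlinarith
      · have := mul_le_mul_of_nonneg_left hm hs.le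
        rw [mul_inv_cancel₀ hs.ne'] at this
        linarith
      · have h3 := le_tangentSlope_mul hp hm (y := y) ⟨by linarith, hy.2⟩
        have h4 := mul_le_mul_of_nonneg_left h3 hs.le
        rw [mul_sub, mul_inv_cancel₀ hs.ne'] at h4
        nlinarith
  rw [e, Real.volume_Icc, polarWidth]
  congr 1
  ring

theorem IsProfile.continuousOn_polarWidth (h : IsProfile b g) :
    ContinuousOn (polarWidth b g) (Ioo 0 (g 0)⁻¹) := by
  obtain ⟨p, hp, hp'⟩ := h.exists_slope
  have hmap : MapsTo (fun s : ℝ => s⁻¹) (Ioo 0 (g 0)⁻¹) (Ioi (g 0)) := fun s hs =>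
    (lt_inv_comm₀ hs.1 h.zero_pos).1 hs.2
  have hinv : ContinuousOn (fun s : ℝ => s⁻¹) (Ioo 0 (g 0)⁻¹) :=
    continuousOn_inv₀.mono fun s hs => hs.1.ne'
  have c1 := (convexOn_tangentSlope h.height_pos hp).continuousOn isOpen_Ioi
  have c2 := (convexOn_tangentSlope (f := fun y => g (-y)) h.height_pos hp').continuousOn isOpen_Ioi
  rw [neg_zero] at c2
  exact continuousOn_id.neg.mul ((c1.comp hinv hmap).add (c2.comp hinv hmap))

end Slices

/-! ### Horizontal perturbations of a profile -/

theorem eq_of_mul_le_mul_of_add_le {a v ap am vp vm : ℝ} (ha : 0 < a) (hv : 0 < v) (hap : 0 ≤ ap)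
    (ham : 0 ≤ am) (hA : ap + am = 2 * a) (hV : vp + vm ≤ 2 * v)
    (hp : a * v ≤ ap * vp) (hm : a * v ≤ am * vm) : ap = a ∧ vp + vm = 2 * v := by
  have h1 : 2 * a * v * a ≤ 2 * v * (ap * am) := by
    have := mul_le_mul_of_nonneg_left hV (mul_nonneg hap ham)
    have := mul_le_mul_of_nonneg_left hp ham
    have := mul_le_mul_of_nonneg_left hm hap
    have : a * v * (ap + am) = a * v * (2 * a) := by rw [hA]
    linarith
  have h2 : a * a ≤ ap * am := by
    have h3 : 0 < 2 * v := by linarith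
    nlinarith
  have h3 : ap = a := by
    have h4 : (ap - am) ^ 2 ≤ 0 := by nlinarith
    have h5 : ap - am = 0 := pow_eq_zero_iff (two_ne_zero) |>.1 (le_antisymm h4 (sq_nonneg _))
    linarith
  have h4 : am = a := by linarith
  subst h3
  rw [h4] at hm
  have h5 := le_of_mul_le_mul_left hp ha
  have h6 := le_of_mul_le_mul_left hm ha
  exact ⟨rfl, by linarith⟩

section Perturb

variable {b : ℝ} {g β : ℝ → ℝ}

theorem tangentSlope_midpoint (h : IsProfile b g) (hp : IsProfile b (fun y => g y + β y))
    (hm : IsProfile b (fun y => g y - β y)) (hβ0 : β 0 = 0) {m : ℝ} (hgm : g 0 ≤ m) :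
    2 * tangentSlope g b m ≤
      tangentSlope (fun y => g y + β y) b m + tangentSlope (fun y => g y - β y) b m := by
  obtain ⟨p, hpp, -⟩ := hp.exists_slope
  obtain ⟨q, hqq, -⟩ := hm.exists_slope
  simp only [hβ0, add_zero, sub_zero] at hpp hqq
  exact tangentSlope_midpoint_le h.height_pos hβ0 hpp hqq hgm

theorem tangentSlope_neg_midpoint (h : IsProfile b g) (hp : IsProfile b (fun y => g y + β y))
    (hm : IsProfile b (fun y => g y - β y)) (hβ0 : β 0 = 0) {m : ℝ} (hgm : g 0 ≤ m) :
    2 * tangentSlope (fun y => g (-y)) b m ≤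
      tangentSlope (fun y => g (-y) + β (-y)) b m + tangentSlope (fun y => g (-y) - β (-y)) b m :=
  tangentSlope_midpoint (β := fun y => β (-y)) h.comp_neg hp.comp_neg hm.comp_neg
    (by simpa using hβ0) (by simpa using hgm)

theorem polarWidth_midpoint (h : IsProfile b g) (hp : IsProfile b (fun y => g y + β y))
    (hm : IsProfile b (fun y => g y - β y)) (hβ0 : β 0 = 0) {s : ℝ} (hs : 0 < s)
    (hs1 : s ≤ (g 0)⁻¹) :
    polarWidth b (fun y => g y + β y) s + polarWidth b (fun y => g y - β y) s ≤
      2 * polarWidth b g s := by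
  have h1 := tangentSlope_midpoint h hp hm hβ0 (h.le_inv hs1 hs)
  have h2 := tangentSlope_neg_midpoint h hp hm hβ0 (h.le_inv hs1 hs)
  unfold polarWidth
  nlinarith

/-- The slices of the polar body of `g` are at least as long as the mean of those for `g ± β`. The
hypothesis `β 0 = 0` makes the three polar bodies project onto the same interval. -/
theorem polar_slice_midpoint (h : IsProfile b g) (hp : IsProfile b (fun y => g y + β y))
    (hm : IsProfile b (fun y => g y - β y)) (hβ0 : β 0 = 0) {s : ℝ} (hs : s ≠ 0) :
    volume {t : ℝ | !₂[s, t] ∈ polarDual (profileBody b (fun y => g y + β y))} +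
      volume {t : ℝ | !₂[s, t] ∈ polarDual (profileBody b (fun y => g y - β y))} ≤
      2 * volume {t : ℝ | !₂[s, t] ∈ polarDual (profileBody b g)} := by
  wlog hs0 : 0 < s generalizing s
  · have h1 := this (s := -s) (neg_ne_zero.2 hs)
      (by rcases lt_or_gt_of_ne hs with h | h
          · linarith
          · exact absurd h hs0)
    rwa [volume_polarDual_slice_neg hp.isSymmConvexBody.symm,
      volume_polarDual_slice_neg hm.isSymmConvexBody.symm,
      volume_polarDual_slice_neg h.isSymmConvexBody.symm] at h1
  have ep : g 0 + β 0 = g 0 := by rw [hβ0, add_zero]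
  have em : g 0 - β 0 = g 0 := by rw [hβ0, sub_zero]
  rcases le_or_gt s (g 0)⁻¹ with hs1 | hs1
  · rw [hp.volume_polarDual_slice hs0 (by simpa only [ep]),
      hm.volume_polarDual_slice hs0 (by simpa only [em]), h.volume_polarDual_slice hs0 hs1,
      ← ENNReal.ofReal_add (hp.polarWidth_nonneg hs0 (by simpa only [ep]))
        (hm.polarWidth_nonneg hs0 (by simpa only [em])),
      ← ENNReal.ofReal_ofNat 2, ← ENNReal.ofReal_mul (by norm_num)]
    exact ENNReal.ofReal_le_ofReal (polarWidth_midpoint h hp hm hβ0 hs0 hs1)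
  · rw [hp.volume_polarDual_slice_of_lt hs0 (by simpa only [ep]),
      hm.volume_polarDual_slice_of_lt hs0 (by simpa only [em]), add_zero]
    exact zero_le

theorem measurableSet_polarDual (h : IsProfile b g) :
    MeasurableSet (polarDual (profileBody b g)) :=
  (isClosed_polarDual h.isSymmConvexBody.isOpen).measurableSet

theorem volume_polar_add (hp : IsProfile b (fun y => g y + β y))
    (hm : IsProfile b (fun y => g y - β y)) :
    volume (polarDual (profileBody b (fun y => g y + β y))) +
      volume (polarDual (profileBody b (fun y => g y - β y))) =
    ∫⁻ s, (volume {t : ℝ | !₂[s, t] ∈ polarDual (profileBody b (fun y => g y + β y))} +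
      volume {t : ℝ | !₂[s, t] ∈ polarDual (profileBody b (fun y => g y - β y))}) := by
  rw [lintegral_add_left (measurable_volume_fst (measurableSet_polarDual hp)),
    ← volume_eq_lintegral_fst (measurableSet_polarDual hp),
    ← volume_eq_lintegral_fst (measurableSet_polarDual hm)]

theorem two_mul_volume_polar (h : IsProfile b g) :
    2 * volume (polarDual (profileBody b g)) =
    ∫⁻ s, 2 * volume {t : ℝ | !₂[s, t] ∈ polarDual (profileBody b g)} := by
  rw [lintegral_const_mul _ (measurable_volume_fst (measurableSet_polarDual h)),
    ← volume_eq_lintegral_fst (measurableSet_polarDual h)]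

theorem ae_polar_slice_midpoint (h : IsProfile b g) (hp : IsProfile b (fun y => g y + β y))
    (hm : IsProfile b (fun y => g y - β y)) (hβ0 : β 0 = 0) :
    (fun s : ℝ => volume {t : ℝ | !₂[s, t] ∈ polarDual (profileBody b (fun y => g y + β y))} +
      volume {t : ℝ | !₂[s, t] ∈ polarDual (profileBody b (fun y => g y - β y))}) ≤ᵐ[volume]
      fun s : ℝ => 2 * volume {t : ℝ | !₂[s, t] ∈ polarDual (profileBody b g)} := by
  filter_upwards [compl_mem_ae_iff.2 (measure_singleton (0 : ℝ))] with s hs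
  exact polar_slice_midpoint h hp hm hβ0 hs

/-- The area of the polar body is concave along the perturbation. -/
theorem volume_polar_midpoint (h : IsProfile b g) (hp : IsProfile b (fun y => g y + β y))
    (hm : IsProfile b (fun y => g y - β y)) (hβ0 : β 0 = 0) :
    volume (polarDual (profileBody b (fun y => g y + β y))) +
      volume (polarDual (profileBody b (fun y => g y - β y))) ≤
      2 * volume (polarDual (profileBody b g)) := by
  rw [volume_polar_add hp hm, two_mul_volume_polar h]
  exact lintegral_mono_ae (ae_polar_slice_midpoint h hp hm hβ0)

theorem polarWidth_midpoint_eq (h : IsProfile b g) (hp : IsProfile b (fun y => g y + β y))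
    (hm : IsProfile b (fun y => g y - β y)) (hβ0 : β 0 = 0)
    (heq : volume (polarDual (profileBody b (fun y => g y + β y))) +
      volume (polarDual (profileBody b (fun y => g y - β y))) =
      2 * volume (polarDual (profileBody b g))) {s : ℝ} (hs : s ∈ Ioo 0 (g 0)⁻¹) :
    polarWidth b (fun y => g y + β y) s + polarWidth b (fun y => g y - β y) s =
      2 * polarWidth b g s := by
  have ep : g 0 + β 0 = g 0 := by rw [hβ0, add_zero]
  have em : g 0 - β 0 = g 0 := by rw [hβ0, sub_zero]
  have hfin : volume (polarDual (profileBody b g)) ≠ ⊤ :=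
    volume_polarDual_ne_top h.isSymmConvexBody.isOpen h.zero_mem_body
  have hae := ae_eq_of_ae_le_of_lintegral_le (ae_polar_slice_midpoint h hp hm hβ0)
    (by rw [← volume_polar_add hp hm, heq]; exact ENNReal.mul_ne_top (by norm_num) hfin)
    ((measurable_volume_fst (measurableSet_polarDual h)).const_mul 2).aemeasurable
    (by rw [← volume_polar_add hp hm, heq, two_mul_volume_polar h])
  have hcp := hp.continuousOn_polarWidth
  have hcm := hm.continuousOn_polarWidth
  simp only [ep, em] at hcp hcm
  refine Measure.eqOn_open_of_ae_eq (μ := volume)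
    (f := fun s => polarWidth b (fun y => g y + β y) s + polarWidth b (fun y => g y - β y) s)
    (g := fun s => 2 * polarWidth b g s) ?_ isOpen_Ioo (hcp.add hcm)
    (continuousOn_const.mul h.continuousOn_polarWidth) hs
  filter_upwards [ae_restrict_of_ae hae, ae_restrict_mem measurableSet_Ioo] with s hs hs'
  have hs1 := hs'.2.le
  have hwp := hp.polarWidth_nonneg hs'.1 (by simpa only [ep])
  have hwm := hm.polarWidth_nonneg hs'.1 (by simpa only [em])
  have hw := h.polarWidth_nonneg hs'.1 hs1
  rw [hp.volume_polarDual_slice hs'.1 (by simpa only [ep]),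
    hm.volume_polarDual_slice hs'.1 (by simpa only [em]), h.volume_polarDual_slice hs'.1 hs1,
    ← ENNReal.ofReal_add hwp hwm, ← ENNReal.ofReal_ofNat 2, ← ENNReal.ofReal_mul (by norm_num),
    ENNReal.ofReal_eq_ofReal_iff (by linarith) (by linarith)] at hs
  exact hs

/-- If the area of the polar body is affine along the perturbation, then the perturbation is linear
on either side of the horizontal axis. -/
theorem linear_halves_of_volume_polar_eq (h : IsProfile b g) (hc : ContinuousOn g (Icc (-b) b))
    (hp : IsProfile b (fun y => g y + β y))
    (hm : IsProfile b (fun y => g y - β y)) (hβ0 : β 0 = 0)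
    (heq : volume (polarDual (profileBody b (fun y => g y + β y))) +
      volume (polarDual (profileBody b (fun y => g y - β y))) =
      2 * volume (polarDual (profileBody b g))) :
    (∃ c, ∀ y ∈ Ioo 0 b, β y = c * y) ∧ ∃ c, ∀ y ∈ Ioo 0 b, β (-y) = c * y := by
  have hb := h.height_pos
  have hsub : Icc 0 b ⊆ Icc (-b) b := Icc_subset_Icc (by linarith) le_rfl
  have hmaps : MapsTo (fun y : ℝ => -y) (Icc 0 b) (Icc (-b) b) := fun y hy =>
    neg_mem_Icc_neg (hsub hy)
  have slopes : ∀ m, g 0 < m →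
      2 * tangentSlope g b m =
        tangentSlope (fun y => g y + β y) b m + tangentSlope (fun y => g y - β y) b m ∧
      2 * tangentSlope (fun y => g (-y)) b m =
      tangentSlope (fun y => g (-y) + β (-y)) b m +
        tangentSlope (fun y => g (-y) - β (-y)) b m := by
    intro m hgm
    have hm0 : 0 < m := h.zero_pos.trans hgm
    have h1 := tangentSlope_midpoint h hp hm hβ0 hgm.le
    have h2 := tangentSlope_neg_midpoint h hp hm hβ0 hgm.le
    have h3 := polarWidth_midpoint_eq h hp hm hβ0 heq (s := m⁻¹)
      ⟨inv_pos.2 hm0, inv_strictAnti₀ h.zero_pos hgm⟩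
    simp only [polarWidth, inv_inv] at h3
    have h4 : m⁻¹ * ((tangentSlope (fun y => g y + β y) b m +
        tangentSlope (fun y => g y - β y) b m - 2 * tangentSlope g b m) +
        (tangentSlope (fun y => g (-y) + β (-y)) b m +
        tangentSlope (fun y => g (-y) - β (-y)) b m -
          2 * tangentSlope (fun y => g (-y)) b m)) = 0 := by
      linarith
    have h5 := (mul_eq_zero.1 h4).resolve_left (inv_pos.2 hm0).ne'
    constructor <;> linarith
  obtain ⟨r, hr, hr'⟩ := h.exists_slope
  obtain ⟨p, hpp, hpp'⟩ := hp.exists_slope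
  obtain ⟨q, hqq, hqq'⟩ := hm.exists_slope
  simp only [neg_zero, hβ0, add_zero, sub_zero] at hr' hpp hpp' hqq hqq'
  constructor
  · exact eq_const_mul_of_tangentSlope_midpoint hb hβ0 (hc.mono hsub)
      (h.concave.subset hsub (convex_Icc _ _)) (hp.concave.subset hsub (convex_Icc _ _))
      (hm.concave.subset hsub (convex_Icc _ _)) hr hpp hqq fun m hgm => (slopes m hgm).1
  · exact eq_const_mul_of_tangentSlope_midpoint (g := fun y => g (-y)) (β := fun y => β (-y)) hb
      (by simpa using hβ0) (hc.comp continuous_neg.continuousOn hmaps)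
      (h.comp_neg.concave.subset hsub (convex_Icc _ _))
      (hp.comp_neg.concave.subset hsub (convex_Icc _ _))
      (hm.comp_neg.concave.subset hsub (convex_Icc _ _))
      (r := -r) (p := -p) (q := -q) (by simpa only [neg_zero] using hr')
      (by simpa only [neg_zero] using hpp') (by simpa only [neg_zero] using hqq')
      fun m hgm => (slopes m (by simpa using hgm)).2

theorem IsProfile.continuousOn_width (h : IsProfile b g) :
    ContinuousOn (fun y => ENNReal.ofReal (g y + g (-y))) (Ioo (-b) b) :=
  ENNReal.continuous_ofReal.comp_continuousOn
    (h.continuousOn_Ioo.add h.comp_neg.continuousOn_Ioo)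

theorem IsProfile.volume_body_ne_top (h : IsProfile b g) : volume (profileBody b g) ≠ ⊤ :=
  h.isSymmConvexBody.isBounded.measure_lt_top.ne

theorem IsProfile.volume_body_ne_zero (h : IsProfile b g) : volume (profileBody b g) ≠ 0 :=
  (h.isSymmConvexBody.isOpen.measure_pos _ h.isSymmConvexBody.nonempty).ne'

/-- The area of the body is affine along the perturbation. -/
theorem volume_body_midpoint (h : IsProfile b g) (hp : IsProfile b (fun y => g y + β y))
    (hm : IsProfile b (fun y => g y - β y)) :
    volume (profileBody b (fun y => g y + β y)) + volume (profileBody b (fun y => g y - β y)) =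
      2 * volume (profileBody b g) := by
  rw [h.volume_body, hp.volume_body, hm.volume_body,
    ← lintegral_add_left' (hp.continuousOn_width.aemeasurable measurableSet_Ioo),
    ← lintegral_const_mul'' _ (h.continuousOn_width.aemeasurable measurableSet_Ioo)]
  refine setLIntegral_congr_fun measurableSet_Ioo fun y hy => ?_
  have h1 := hp.width_pos hy
  have h2 := hm.width_pos hy
  rw [← ENNReal.ofReal_add h1.le h2.le, ← ENNReal.ofReal_ofNat 2,
    ← ENNReal.ofReal_mul (by norm_num)]
  congr 1
  ring

theorem width_eq_of_volume_eq {g₁ g₂ : ℝ → ℝ} (h₁ : IsProfile b g₁) (h₂ : IsProfile b g₂)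
    (hle : ∀ y ∈ Ioo (-b) b, g₁ y + g₁ (-y) ≤ g₂ y + g₂ (-y))
    (heq : volume (profileBody b g₁) = volume (profileBody b g₂)) {y : ℝ} (hy : y ∈ Ioo (-b) b) :
    g₁ y + g₁ (-y) = g₂ y + g₂ (-y) := by
  have hfin := h₁.volume_body_ne_top
  rw [h₁.volume_body] at heq hfin
  rw [h₂.volume_body] at heq
  have hae := ae_eq_of_ae_le_of_lintegral_le
    ((ae_restrict_iff' measurableSet_Ioo).2
      (ae_of_all _ fun y hy => ENNReal.ofReal_le_ofReal (hle y hy))) hfin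
    (h₂.continuousOn_width.aemeasurable measurableSet_Ioo) heq.ge
  have := Measure.eqOn_open_of_ae_eq hae isOpen_Ioo h₁.continuousOn_width h₂.continuousOn_width hy
  exact (ENNReal.ofReal_eq_ofReal_iff (h₁.width_pos hy).le (h₂.width_pos hy).le).1 this

/-- A body that is no worse than its two perturbations `g ± β` admits only shears `β y = c y`.
The area is affine and the polar area is concave, so their product has a midpoint minimum only if
the first is constant and the second is affine. -/
theorem linear_of_mahlerVolume_le (h : IsProfile b g) (hc : ContinuousOn g (Icc (-b) b))
    (hp : IsProfile b (fun y => g y + β y)) (hm : IsProfile b (fun y => g y - β y)) (hβ0 : β 0 = 0)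
    (hlep : mahlerVolume (profileBody b g) ≤ mahlerVolume (profileBody b (fun y => g y + β y)))
    (hlem : mahlerVolume (profileBody b g) ≤ mahlerVolume (profileBody b (fun y => g y - β y))) :
    ∃ c, ∀ y ∈ Ioo (-b) b, β y = c * y := by
  have hb := h.height_pos
  have polar_ne_top : ∀ {f : ℝ → ℝ}, IsProfile b f → volume (polarDual (profileBody b f)) ≠ ⊤ :=
    fun hf => volume_polarDual_ne_top hf.isSymmConvexBody.isOpen hf.zero_mem_body
  have hV := volume_polar_midpoint h hp hm hβ0
  have hA := volume_body_midpoint h hp hm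
  have hA' := congrArg ENNReal.toReal hA
  rw [ENNReal.toReal_add hp.volume_body_ne_top hm.volume_body_ne_top, ENNReal.toReal_mul] at hA'
  have hV' := ENNReal.toReal_mono (ENNReal.mul_ne_top (by norm_num) (polar_ne_top h)) hV
  rw [ENNReal.toReal_add (polar_ne_top hp) (polar_ne_top hm), ENNReal.toReal_mul] at hV'
  have hlep' := ENNReal.toReal_mono (ENNReal.mul_ne_top hp.volume_body_ne_top (polar_ne_top hp)) hlep
  have hlem' := ENNReal.toReal_mono (ENNReal.mul_ne_top hm.volume_body_ne_top (polar_ne_top hm)) hlem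
  simp only [mahlerVolume, ENNReal.toReal_mul] at hlep' hlem'
  obtain ⟨e1, e2⟩ := eq_of_mul_le_mul_of_add_le
    (ENNReal.toReal_pos h.volume_body_ne_zero h.volume_body_ne_top)
    (ENNReal.toReal_pos (volume_polarDual_ne_zero h.isSymmConvexBody.isBounded) (polar_ne_top h))
    ENNReal.toReal_nonneg ENNReal.toReal_nonneg (by simpa using hA') (by simpa using hV')
    hlep' hlem'
  have e1' : volume (profileBody b (fun y => g y + β y)) = volume (profileBody b g) :=
    (ENNReal.toReal_eq_toReal_iff' hp.volume_body_ne_top h.volume_body_ne_top).1 e1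
  have e1'' : volume (profileBody b (fun y => g y - β y)) = volume (profileBody b g) := by
    refine (ENNReal.toReal_eq_toReal_iff' hm.volume_body_ne_top h.volume_body_ne_top).1 ?_
    simp only [ENNReal.toReal_ofNat] at hA'
    linarith
  have e2' : volume (polarDual (profileBody b (fun y => g y + β y))) +
      volume (polarDual (profileBody b (fun y => g y - β y))) =
      2 * volume (polarDual (profileBody b g)) := by
    refine (ENNReal.toReal_eq_toReal_iff' (ENNReal.add_ne_top.2 ⟨polar_ne_top hp, polar_ne_top hm⟩)
      (ENNReal.mul_ne_top (by norm_num) (polar_ne_top h))).1 ?_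
    rw [ENNReal.toReal_add (polar_ne_top hp) (polar_ne_top hm), ENNReal.toReal_mul, e2]
    simp
  obtain ⟨⟨c, hc1⟩, c', hc2⟩ := linear_halves_of_volume_polar_eq h hc hp hm hβ0 e2'
  have hsum : ∀ y ∈ Ioo (-b) b, β y + β (-y) = (c + c') * |y| := by
    intro y hy
    rcases lt_trichotomy y 0 with h0 | rfl | h0
    · have a1 := hc1 (-y) ⟨by linarith, by linarith [hy.1]⟩
      have a2 := hc2 (-y) ⟨by linarith, by linarith [hy.1]⟩
      rw [neg_neg] at a2
      rw [abs_of_neg h0]; linarith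
    · simp [hβ0]
    · have a1 := hc1 y ⟨by linarith, hy.2⟩
      have a2 := hc2 y ⟨by linarith, hy.2⟩
      rw [abs_of_pos h0]; linarith
  -- the area changes by a multiple of `c + c'`
  have hcc : c + c' = 0 := by
    have hmid : b / 2 ∈ Ioo (-b) b := ⟨by linarith, by linarith⟩
    have hs := hsum _ hmid
    rw [abs_of_pos (by linarith)] at hs
    have : (c + c') * (b / 2) = 0 := by
      rcases le_total 0 (c + c') with h0 | h0
      · have := width_eq_of_volume_eq h hp (fun y hy => by
          have := hsum y hy
          have := mul_nonneg h0 (abs_nonneg y)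
          linarith) e1'.symm hmid
        linarith
      · have := width_eq_of_volume_eq h hm (fun y hy => by
          have := hsum y hy
          have := mul_nonneg (neg_nonneg.2 h0) (abs_nonneg y)
          linarith) e1''.symm hmid
        linarith
    exact (mul_eq_zero.1 this).resolve_right (by linarith)
  refine ⟨c, fun y hy => ?_⟩
  rcases lt_trichotomy y 0 with h0 | rfl | h0
  · have a2 := hc2 (-y) ⟨by linarith, by linarith [hy.1]⟩
    rw [neg_neg] at a2
    rw [a2, show c' = -c by linarith]; ring
  · simp [hβ0]
  · exact hc1 y ⟨by linarith, hy.2⟩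

end Perturb

theorem supportFun_le_add {b δ : ℝ} {g₁ g₂ : ℝ → ℝ} (h₁ : IsProfile b g₁) (h₂ : IsProfile b g₂)
    (hδ : ∀ y ∈ Ioo (-b) b, |g₁ y - g₂ y| ≤ δ) (θ : ℝ) :
    supportFun (profileBody b g₁) θ ≤ supportFun (profileBody b g₂) θ + δ := by
  refine supportFun_le h₁.isSymmConvexBody.nonempty fun x hx => ?_
  obtain ⟨hy, hx1, hx2⟩ := hx
  set y := x 1 with hydef
  have w1 := h₁.width_pos hy
  have w2 := h₂.width_pos hy
  -- compare with the point that divides the slice of the second body in the same ratio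
  set l := (x 0 + g₁ (-y)) / (g₁ y + g₁ (-y)) with hl
  have hl0 : 0 < l := div_pos (by linarith) w1
  have hl1 : l < 1 := by rw [hl, div_lt_one w1]; linarith
  have hlx : l * (g₁ y + g₁ (-y)) = x 0 + g₁ (-y) := div_mul_cancel₀ _ w1.ne'
  obtain ⟨B, hB⟩ := exists_abs_le_of_concaveOn h₂.height_pos h₂.concave
  have hmem : !₂[-g₂ (-y) + l * (g₂ y + g₂ (-y)), y] ∈ profileBody b g₂ := by
    refine ⟨hy, ?_, ?_⟩
    · have := mul_pos hl0 w2
      simp; linarith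
    · have := mul_pos (sub_pos.2 hl1) w2
      simp; linarith
  have key := le_supportFun (fun p hp => norm_le_of_mem_profileBody hB hp) hmem θ
  rw [inner_angle] at key ⊢
  simp only [Matrix.cons_val_zero, Matrix.cons_val_one] at key
  have d1 := abs_le.1 (hδ _ hy)
  have d2 := abs_le.1 (hδ _ (neg_mem_Ioo_neg hy))
  have hdist : |x 0 - (-g₂ (-y) + l * (g₂ y + g₂ (-y)))| ≤ δ := by
    have e : x 0 - (-g₂ (-y) + l * (g₂ y + g₂ (-y))) =
        l * (g₁ y - g₂ y) - (1 - l) * (g₁ (-y) - g₂ (-y)) := by linarith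
    rw [e, abs_le]
    have := mul_le_mul_of_nonneg_left d1.1 hl0.le
    have := mul_le_mul_of_nonneg_left d1.2 hl0.le
    have := mul_le_mul_of_nonneg_left d2.1 (sub_pos.2 hl1).le
    have := mul_le_mul_of_nonneg_left d2.2 (sub_pos.2 hl1).le
    constructor <;> linarith
  have hcos : (x 0 - (-g₂ (-y) + l * (g₂ y + g₂ (-y)))) * Real.cos θ ≤ δ := by
    refine (le_abs_self _).trans ?_
    rw [abs_mul]
    calc _ ≤ δ * 1 := mul_le_mul hdist (Real.abs_cos_le_one θ) (abs_nonneg _)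
          ((abs_nonneg _).trans hdist)
      _ = δ := mul_one δ
  linarith

/-- The only admissible perturbations of a local minimizer that fix its points on the horizontal
axis are shears. -/
theorem linear_of_isLocalMinimizer {b : ℝ} {g β : ℝ → ℝ} (h : IsProfile b g)
    (hc : ContinuousOn g (Icc (-b) b)) (hmin : IsLocalMinimizer (profileBody b g)) {t₀ : ℝ}
    (ht₀ : 0 < t₀) (hconc : ∀ t, |t| ≤ t₀ → ConcaveOn ℝ (Icc (-b) b) (fun y => g y + t * β y))
    (hβ0 : β 0 = 0) (hends : 0 < g b + g (-b) ∨ β b + β (-b) = 0) :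
    ∃ c, ∀ y ∈ Ioo (-b) b, β y = c * y := by
  have hb := h.height_pos
  obtain ⟨B, hB⟩ := exists_abs_le_of_concaveOn hb h.concave
  obtain ⟨B', hB'⟩ : ∃ B', ∀ y ∈ Icc (-b) b, |β y| ≤ B' := by
    obtain ⟨D, hD⟩ := exists_abs_le_of_concaveOn hb (hconc t₀ (abs_of_pos ht₀).le)
    refine ⟨(D + B) / t₀, fun y hy => ?_⟩
    rw [le_div_iff₀ ht₀]
    have h1 := abs_le.1 (hD y hy)
    have h2 := abs_le.1 (hB y hy)
    nth_rewrite 1 [← abs_of_pos ht₀]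
    rw [← abs_mul, abs_le]
    constructor <;> linarith
  have hB'0 : 0 ≤ B' := (abs_nonneg _).trans (hB' 0 h.zero_mem_Icc)
  obtain ⟨t₁, ht₁, ht₁1, hprof⟩ : ∃ t₁ > 0, t₁ ≤ 1 ∧
      ∀ t, |t| ≤ t₁ → IsProfile b (fun y => g y + t * β y) := by
    have hz : ∀ t, g 0 + t * β 0 = g 0 := fun t => by rw [hβ0, mul_zero, add_zero]
    rcases hends with he | he
    · refine ⟨min (min t₀ 1) ((g b + g (-b)) / (|β b + β (-b)| + 1)), by positivity,
        (min_le_left _ _).trans (min_le_right _ _), fun t ht => ⟨hb, hconc t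
          (ht.trans ((min_le_left _ _).trans (min_le_left _ _))), by rw [hz]; exact h.zero_pos, ?_⟩⟩
      have h1 := ht.trans (min_le_right _ _)
      rw [le_div_iff₀ (by positivity)] at h1
      have h2 : -(t * (β b + β (-b))) ≤ |t| * |β b + β (-b)| := by
        rw [← abs_mul]; exact neg_le_abs _
      have h3 := abs_nonneg t
      nlinarith
    · refine ⟨min t₀ 1, by positivity, min_le_right _ _, fun t ht => ⟨hb, hconc t
        (ht.trans (min_le_left _ _)), by rw [hz]; exact h.zero_pos, ?_⟩⟩
      have h1 := h.ends
      have h2 : t * β b + t * β (-b) = 0 := by rw [← mul_add, he, mul_zero]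
      linarith
  obtain ⟨-, ε, hε, hloc⟩ := hmin
  have conv : ∀ σ : ℝ, |σ| = t₁ → ∀ᶠ n : ℕ in atTop,
      mahlerVolume (profileBody b g) ≤
        mahlerVolume (profileBody b (fun y => g y + σ * (1 / ((n : ℝ) + 1)) * β y)) := by
    intro σ hσ
    have hle : ∀ n : ℕ, |σ * (1 / ((n : ℝ) + 1))| ≤ t₁ := by
      intro n
      have h1 : 1 / ((n : ℝ) + 1) ≤ 1 := by
        rw [div_le_one (by positivity)]; linarith [n.cast_nonneg (α := ℝ)]
      rw [abs_mul, hσ, abs_of_pos (by positivity)]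
      nlinarith
    have hpn := fun n => hprof _ (hle n)
    have hlim0 : Tendsto (fun n : ℕ => |σ * (1 / ((n : ℝ) + 1))| * B') atTop (𝓝 0) := by
      have := ((tendsto_one_div_add_atTop_nhds_zero_nat (𝕜 := ℝ)).const_mul σ).abs.mul_const B'
      simpa using this
    have hdist : ∀ n : ℕ, ∀ y ∈ Ioo (-b) b,
        |σ * (1 / ((n : ℝ) + 1)) * β y| ≤ |σ * (1 / ((n : ℝ) + 1))| * B' := by
      intro n y hy
      rw [abs_mul]
      exact mul_le_mul_of_nonneg_left (hB' y (Ioo_subset_Icc_self hy)) (abs_nonneg _)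
    have hev := eventually_h1Norm_le (K := profileBody b g)
      (L := fun n : ℕ => profileBody b (fun y => g y + σ * (1 / ((n : ℝ) + 1)) * β y))
      (R := B + B' + b) ⟨0, h.zero_mem_body⟩
      (fun x hx => (norm_le_of_mem_profileBody hB hx).trans (by linarith))
      (fun n => ⟨0, (hpn n).zero_mem_body⟩)
      (fun n x hx => norm_le_of_mem_profileBody (fun y hy => by
        have h1 := hB y hy
        have h2 : |σ * (1 / ((n : ℝ) + 1)) * β y| ≤ B' := by
          rw [abs_mul]
          calc _ ≤ 1 * B' := mul_le_mul ((hle n).trans ht₁1) (hB' y hy) (abs_nonneg _) zero_le_one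
            _ = B' := one_mul B'
        exact (abs_add_le _ _).trans (by linarith)) hx)
      (fun θ => by
        refine tendsto_iff_dist_tendsto_zero.2 (squeeze_zero (fun _ => dist_nonneg) (fun n => ?_)
          hlim0)
        have a1 := supportFun_le_add (hpn n) h (δ := |σ * (1 / ((n : ℝ) + 1))| * B')
          (fun y hy => by simpa using hdist n y hy) θ
        have a2 := supportFun_le_add h (hpn n) (δ := |σ * (1 / ((n : ℝ) + 1))| * B')
          (fun y hy => by simpa using hdist n y hy) θ
        rw [Real.dist_eq, abs_le]
        constructor <;> linarith) hε
    filter_upwards [hev] with n hn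
    exact hloc _ (hpn n).isSymmConvexBody hn
  obtain ⟨n, hn1, hn2⟩ :=
    ((conv t₁ (abs_of_pos ht₁)).and (conv (-t₁) (by rw [abs_neg, abs_of_pos ht₁]))).exists
  set τ := t₁ * (1 / ((n : ℝ) + 1)) with hτ
  have hτ0 : 0 < τ := by positivity
  have hτ1 : τ ≤ t₁ := by
    have h1 : 1 / ((n : ℝ) + 1) ≤ 1 := by
      rw [div_le_one (by positivity)]; linarith [n.cast_nonneg (α := ℝ)]
    nlinarith
  have e : (fun y => g y + -t₁ * (1 / ((n : ℝ) + 1)) * β y) = fun y => g y - τ * β y := by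
    funext y; rw [hτ]; ring
  have hpm := hprof (-τ) (by rwa [abs_neg, abs_of_pos hτ0])
  have e' : (fun y => g y + -τ * β y) = fun y => g y - τ * β y := by
    funext y; ring
  rw [e] at hn2
  rw [e'] at hpm
  obtain ⟨c, hcβ⟩ := linear_of_mahlerVolume_le (β := fun y => τ * β y) h hc
    (hprof τ (by rwa [abs_of_pos hτ0])) hpm (by simp [hβ0]) hn1 hn2
  refine ⟨c / τ, fun y hy => ?_⟩
  have := hcβ y hy
  field_simp
  linarith

/-! ### The profile of a symmetric convex body -/

section ExistsProfile

variable {K : Set (EuclideanSpace ℝ (Fin 2))}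

theorem IsSymmConvexBody.zero_mem (hK : IsSymmConvexBody K) : 0 ∈ K := by
  obtain ⟨x, hx⟩ := hK.nonempty
  have hx' : -x ∈ K := by rw [← hK.symm] at hx; exact hx
  have := hK.convex hx hx' (a := 1 / 2) (b := 1 / 2) (by norm_num) (by norm_num) (by norm_num)
  simpa using this

theorem IsSymmConvexBody.neg_mem_closure (hK : IsSymmConvexBody K)
    {x : EuclideanSpace ℝ (Fin 2)} (hx : x ∈ closure K) : -x ∈ closure K := by
  refine map_mem_closure continuous_neg hx fun y hy => ?_
  rwa [← Set.mem_neg, hK.symm]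

theorem pair_eta (p : EuclideanSpace ℝ (Fin 2)) : !₂[p 0, p 1] = p := by
  ext i; fin_cases i <;> rfl

theorem combo_pair (s t x y x' y' : ℝ) : s • (!₂[x, y] : EuclideanSpace ℝ (Fin 2)) +
    t • !₂[x', y'] = !₂[s * x + t * x', s * y + t * y'] := by
  ext i; fin_cases i <;> simp

theorem IsSymmConvexBody.smul_mem (hK : IsSymmConvexBody K) {x : EuclideanSpace ℝ (Fin 2)}
    (hx : x ∈ closure K) {l : ℝ} (hl : |l| < 1) : l • x ∈ K := by
  wlog h0 : 0 ≤ l generalizing l x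
  · have := this (hK.neg_mem_closure hx) (l := -l) (by rwa [abs_neg]) (by linarith)
    simpa using this
  rcases h0.eq_or_lt with rfl | h0
  · simpa using hK.zero_mem
  · have := hK.convex.openSegment_interior_closure_subset_interior
      (by rw [hK.isOpen.interior_eq]; exact hK.zero_mem) hx
      ⟨1 - l, l, by linarith [(abs_lt.1 hl).2], h0, by ring, rfl⟩
    rw [hK.isOpen.interior_eq] at this
    simpa using this

/-- Every symmetric convex body is the region described by a continuous profile: half-height and
right boundary are read off the closure. -/
theorem exists_profile (hK : IsSymmConvexBody K) :
    ∃ b g, IsProfile b g ∧ ContinuousOn g (Icc (-b) b) ∧ K = profileBody b g := by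
  have hC : IsCompact (closure K) := hK.isBounded.isCompact_closure
  have hCc : Convex ℝ (closure K) := hK.convex.closure
  have hc0 : Continuous fun p : EuclideanSpace ℝ (Fin 2) => p 0 := by fun_prop
  have hc1 : Continuous fun p : EuclideanSpace ℝ (Fin 2) => p 1 := by fun_prop
  obtain ⟨T, hT, hTmax⟩ := hC.exists_isMaxOn ⟨0, subset_closure hK.zero_mem⟩ hc1.continuousOn
  set b := T 1 with hb
  have hle : ∀ p ∈ closure K, p 1 ≤ b := fun p hp => hTmax hp
  have hge : ∀ p ∈ closure K, -b ≤ p 1 := fun p hp => by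
    have := hle _ (hK.neg_mem_closure hp)
    rw [PiLp.neg_apply] at this
    linarith
  -- a point of the body can be moved upwards and sideways
  have hlt : ∀ p ∈ K, ∃ r > 0, !₂[p 0, p 1 + r] ∈ K ∧ !₂[p 0 + r, p 1] ∈ K := by
    intro p hp
    have c1 : Continuous fun r : ℝ => (!₂[p 0, p 1 + r] : EuclideanSpace ℝ (Fin 2)) := by fun_prop
    have c2 : Continuous fun r : ℝ => (!₂[p 0 + r, p 1] : EuclideanSpace ℝ (Fin 2)) := by fun_prop
    have e1 := (c1.tendsto 0).eventually (hK.isOpen.mem_nhds (by simpa [pair_eta] using hp))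
    have e2 := (c2.tendsto 0).eventually (hK.isOpen.mem_nhds (by simpa [pair_eta] using hp))
    have e3 : ∀ᶠ r in 𝓝[>] (0 : ℝ), (0 : ℝ) < r := self_mem_nhdsWithin
    obtain ⟨r, ⟨h1, h2⟩, h3⟩ :=
      (((e1.and e2).filter_mono nhdsWithin_le_nhds).and e3).exists
    exact ⟨r, h3, h1, h2⟩
  have hltb : ∀ p ∈ K, p 1 < b := by
    intro p hp
    obtain ⟨r, hr, h1, -⟩ := hlt p hp
    have := hle _ (subset_closure h1)
    simp at this
    linarith
  have hb0 : 0 < b := by simpa using hltb 0 hK.zero_mem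
  have hslice : ∀ y ∈ Ioo (-b) b, (y / b) • T ∈ K := fun y hy =>
    hK.smul_mem hT (by rw [abs_div, abs_of_pos hb0, div_lt_one hb0]; exact abs_lt.2 hy)
  have hex : ∀ y, ∃ x, y ∈ Icc (-b) b → !₂[x, y] ∈ closure K ∧
      ∀ x', !₂[x', y] ∈ closure K → x' ≤ x := by
    intro y
    by_cases hy : y ∈ Icc (-b) b
    · have hne : (closure K ∩ {p | p 1 = y}).Nonempty := by
        rcases hy.1.eq_or_lt with h1 | h1
        · exact ⟨-T, hK.neg_mem_closure hT, by simp [← h1, hb]⟩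
        rcases hy.2.eq_or_lt with h2 | h2
        · exact ⟨T, hT, by simp [h2, hb]⟩
        · refine ⟨_, subset_closure (hslice y ⟨h1, h2⟩), ?_⟩
          simp only [mem_ofPred_eq, PiLp.smul_apply, smul_eq_mul]
          exact div_mul_cancel₀ _ hb0.ne'
      obtain ⟨p, ⟨hp, hpy⟩, hmax⟩ := (hC.inter_right
        (isClosed_eq hc1 continuous_const)).exists_isMaxOn hne hc0.continuousOn
      have hpy' : p 1 = y := hpy
      refine ⟨p 0, fun _ => ⟨by rwa [← hpy', pair_eta], fun x' hx' => ?_⟩⟩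
      exact hmax (a := !₂[x', y]) ⟨hx', rfl⟩
    · exact ⟨0, fun h => absurd h hy⟩
  choose g hg using hex
  have hgmem := fun y hy => (hg y hy).1
  have hgmax : ∀ p ∈ closure K, p 0 ≤ g (p 1) := fun p hp =>
    (hg (p 1) ⟨hge p hp, hle p hp⟩).2 (p 0) (by rwa [pair_eta])
  have hgmin : ∀ p ∈ closure K, -g (-p 1) ≤ p 0 := fun p hp => by
    have := hgmax _ (hK.neg_mem_closure hp)
    simp only [PiLp.neg_apply] at this
    linarith
  have hconc : ConcaveOn ℝ (Icc (-b) b) g := by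
    refine ⟨convex_Icc _ _, fun x hx y hy s t hs ht hst => ?_⟩
    have := hCc (hgmem x hx) (hgmem y hy) hs ht hst
    rw [combo_pair] at this
    exact hgmax _ this
  have h0 : (0 : ℝ) ∈ Icc (-b) b := ⟨by linarith, hb0.le⟩
  have hprof : IsProfile b g := by
    refine ⟨hb0, hconc, ?_, ?_⟩
    · obtain ⟨r, hr, -, h2⟩ := hlt 0 hK.zero_mem
      have := hgmax _ (subset_closure h2)
      simp at this
      linarith
    · have h1 := hgmax T hT
      have h2 := hgmin T hT
      rw [← hb] at h1 h2
      linarith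
  refine ⟨b, g, hprof, ?_, ?_⟩
  · intro y hy
    refine tendsto_order.2 ⟨fun r hr => ?_, fun r hr => ?_⟩
    · -- lower semicontinuity comes from concavity
      by_cases hyi : y ∈ Ioo (-b) b
      · exact ((hprof.continuousOn_Ioo.continuousAt (isOpen_Ioo.mem_nhds hyi)).continuousWithinAt
          |>.tendsto).eventually (lt_mem_nhds hr)
      · have hy0 : y ≠ 0 := by
          rintro rfl
          exact hyi ⟨by linarith, hb0⟩
        have hyb : |y| = b := by
          rcases hy.1.eq_or_lt with h1 | h1
          · rw [← h1, abs_neg, abs_of_pos hb0]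
          · rcases hy.2.eq_or_lt with h2 | h2
            · rw [h2, abs_of_pos hb0]
            · exact absurd ⟨h1, h2⟩ hyi
        have hcq : Continuous fun z : ℝ => z / y := by fun_prop
        have hq0 : ∀ᶠ z in 𝓝[Icc (-b) b] y, 0 < z / y :=
          ((hcq.tendsto y).eventually (lt_mem_nhds (by rw [div_self hy0]; exact one_pos))).filter_mono
            nhdsWithin_le_nhds
        have hq1 : ∀ᶠ z in 𝓝[Icc (-b) b] y, r < z / y * g y + (1 - z / y) * g 0 := by
          have hc : Continuous fun z : ℝ => z / y * g y + (1 - z / y) * g 0 := by fun_prop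
          exact ((hc.tendsto y).eventually (lt_mem_nhds (by
            rw [div_self hy0]; linarith))).filter_mono nhdsWithin_le_nhds
        filter_upwards [hq0, hq1, self_mem_nhdsWithin] with z hz0 hz1 hz
        have hz2 : z / y ≤ 1 := by
          refine (le_abs_self _).trans ?_
          rw [abs_div, hyb, div_le_one hb0]
          exact abs_le.2 hz
        have h1 := hconc.2 hy h0 hz0.le (sub_nonneg.2 hz2) (by ring)
        simp only [smul_eq_mul, mul_zero, add_zero, div_mul_cancel₀ _ hy0] at h1
        linarith
    · -- upper semicontinuity comes from compactness of the closure
      have hcl : IsClosed ((fun p : EuclideanSpace ℝ (Fin 2) => p 1) ''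
          (closure K ∩ {p | r ≤ p 0})) :=
        ((hC.inter_right (isClosed_le continuous_const hc0)).image hc1).isClosed
      have hnot : y ∉ (fun p : EuclideanSpace ℝ (Fin 2) => p 1) '' (closure K ∩ {p | r ≤ p 0}) := by
        rintro ⟨p, ⟨hp, hpr⟩, rfl⟩
        have hpr' : r ≤ p 0 := hpr
        have := hgmax p hp
        simp only at hr
        linarith
      filter_upwards [nhdsWithin_le_nhds (hcl.isOpen_compl.mem_nhds hnot), self_mem_nhdsWithin]
        with z hz hz'
      by_contra! hlt
      exact hz ⟨!₂[g z, z], ⟨hgmem z hz', hlt⟩, rfl⟩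
  · ext p
    constructor
    · intro hp
      have hup := hltb p hp
      have hnp : -p ∈ K := by rw [← hK.symm] at hp; exact hp
      have hdown := hltb _ hnp
      obtain ⟨r, hr, -, h2⟩ := hlt p hp
      obtain ⟨r', hr', -, h2'⟩ := hlt _ hnp
      have h3 := hgmax _ (subset_closure h2)
      have h3' := hgmax _ (subset_closure h2')
      simp only [PiLp.neg_apply] at hdown h3'
      simp at h3 h3'
      exact ⟨⟨by linarith, hup⟩, by linarith, by linarith⟩
    · rintro ⟨hy, h1, h2⟩
      have hyI := Ioo_subset_Icc_self hy
      set q := (p 1 / b) • T with hq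
      have hqK : q ∈ K := hslice _ hy
      have hq1 : q 1 = p 1 := by
        simp only [hq, PiLp.smul_apply, smul_eq_mul]
        exact div_mul_cancel₀ _ hb0.ne'
      have hqint : q ∈ interior K := by rwa [hK.isOpen.interior_eq]
      -- `p` lies between `q` and a boundary point of the same height
      have key : ∀ x, !₂[x, p 1] ∈ closure K → (q 0 < p 0 ∧ p 0 < x ∨ x < p 0 ∧ p 0 < q 0) →
          p ∈ K := by
        intro x hx hbetw
        rw [← hK.isOpen.interior_eq]
        refine hK.convex.openSegment_interior_closure_subset_interior hqint hx
          ⟨(x - p 0) / (x - q 0), (p 0 - q 0) / (x - q 0), ?_, ?_, ?_, ?_⟩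
        · rcases hbetw with h | h
          · exact div_pos (by linarith) (by linarith)
          · exact div_pos_of_neg_of_neg (by linarith) (by linarith)
        · rcases hbetw with h | h
          · exact div_pos (by linarith) (by linarith)
          · exact div_pos_of_neg_of_neg (by linarith) (by linarith)
        · have : x - q 0 ≠ 0 := by rcases hbetw with h | h <;> intro h0 <;> linarith
          field_simp
          ring
        · have hne : x - q 0 ≠ 0 := by rcases hbetw with h | h <;> intro h0 <;> linarith
          rw [← pair_eta q, combo_pair, hq1, ← pair_eta p]
          congr 1
          simp only [Matrix.cons_val_zero, Matrix.cons_val_one]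
          congr 2
          · field_simp
            ring
          · field_simp
            ring
      rcases lt_trichotomy (q 0) (p 0) with h | h | h
      · exact key (g (p 1)) (hgmem _ hyI) (Or.inl ⟨h, h2⟩)
      · have : p = q := by rw [← pair_eta p, ← pair_eta q, h, hq1]
        rwa [this]
      · refine key (-g (-p 1)) ?_ (Or.inr ⟨h1, h⟩)
        have := hK.neg_mem_closure (hgmem _ (neg_mem_Icc_neg hyI))
        convert this using 1
        ext i; fin_cases i <;> simp

end ExistsProfile

/-! ### Piecewise affine profiles -/

/-- `g` agrees with an affine function on `s`. -/
def IsAffineOn (g : ℝ → ℝ) (s : Set ℝ) : Prop :=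
  ∃ k p, ∀ y ∈ s, g y = k + p * y

theorem IsAffineOn.mono {g : ℝ → ℝ} {s t : Set ℝ} (h : IsAffineOn g t) (hst : s ⊆ t) :
    IsAffineOn g s := by
  obtain ⟨k, p, hkp⟩ := h
  exact ⟨k, p, fun y hy => hkp y (hst hy)⟩

theorem IsAffineOn.of_subset_closure {g : ℝ → ℝ} {s t : Set ℝ} (h : IsAffineOn g s)
    (hc : ContinuousOn g t) (hst : s ⊆ t) (hts : t ⊆ closure s) : IsAffineOn g t := by
  obtain ⟨k, p, hkp⟩ := h
  have h1 : EqOn g (fun y => k + p * y) s := hkp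
  exact ⟨k, p, h1.of_subset_closure hc (by fun_prop) hst hts⟩

theorem affine_coeff_unique {k p k' p' u v : ℝ} (huv : u ≠ v) (hu : k + p * u = k' + p' * u)
    (hv : k + p * v = k' + p' * v) : k = k' ∧ p = p' := by
  have h1 : (p - p') * (u - v) = 0 := by linarith
  have h2 : p = p' := by
    have := (mul_eq_zero.1 h1).resolve_right (sub_ne_zero.2 huv)
    linarith
  subst h2
  exact ⟨by linarith, rfl⟩

theorem isAffineOn_Ioc {g : ℝ → ℝ} {e b : ℝ} (heb : e < b)
    (h : ∀ c ∈ Ioo e b, IsAffineOn g (Icc c b)) : IsAffineOn g (Ioc e b) := by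
  obtain ⟨c, hc⟩ := nonempty_Ioo.2 heb
  obtain ⟨k, p, hkp⟩ := h c hc
  refine ⟨k, p, fun y hy => ?_⟩
  rcases le_or_gt c y with hcy | hcy
  · exact hkp y ⟨hcy, hy.2⟩
  · obtain ⟨k', p', hkp'⟩ := h y ⟨hy.1, hcy.trans hc.2⟩
    obtain ⟨rfl, rfl⟩ := affine_coeff_unique hc.2.ne
      ((hkp c ⟨le_rfl, hc.2.le⟩).symm.trans (hkp' c ⟨hcy.le, hc.2.le⟩))
      ((hkp b ⟨hc.2.le, le_rfl⟩).symm.trans (hkp' b ⟨hy.2, le_rfl⟩))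
    exact hkp' y ⟨le_rfl, hy.2⟩

theorem isAffineOn_Ico {g : ℝ → ℝ} {a e : ℝ} (hae : a < e)
    (h : ∀ c ∈ Ioo a e, IsAffineOn g (Icc a c)) : IsAffineOn g (Ico a e) := by
  obtain ⟨c, hc⟩ := nonempty_Ioo.2 hae
  obtain ⟨k, p, hkp⟩ := h c hc
  refine ⟨k, p, fun y hy => ?_⟩
  rcases le_or_gt y c with hcy | hcy
  · exact hkp y ⟨hy.1, hcy⟩
  · obtain ⟨k', p', hkp'⟩ := h y ⟨hc.1.trans hcy, hy.2⟩
    obtain ⟨rfl, rfl⟩ := affine_coeff_unique hc.1.ne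
      ((hkp a ⟨le_rfl, hc.1.le⟩).symm.trans (hkp' a ⟨le_rfl, hy.1⟩))
      ((hkp c ⟨hc.1.le, le_rfl⟩).symm.trans (hkp' c ⟨hc.1.le, hcy.le⟩))
    exact hkp' y ⟨hy.1, le_rfl⟩

/-- A function which is affine on one side of every point has at most one corner. -/
theorem isAffineOn_or_exists_corner {g : ℝ → ℝ} {a b : ℝ} (hab : a < b)
    (hc : ContinuousOn g (Icc a b))
    (h : ∀ c ∈ Ioo a b, IsAffineOn g (Icc a c) ∨ IsAffineOn g (Icc c b)) :
    IsAffineOn g (Ioo a b) ∨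
      ∃ c ∈ Ioo a b, IsAffineOn g (Icc a c) ∧ IsAffineOn g (Icc c b) := by
  set A := {c | c ∈ Ioo a b ∧ IsAffineOn g (Icc a c)} with hA
  rcases A.eq_empty_or_nonempty with he | hne
  · refine Or.inl ((isAffineOn_Ioc hab fun c hcI => (h c hcI).resolve_left fun h1 => ?_).mono
      Ioo_subset_Ioc_self)
    have : c ∈ A := ⟨hcI, h1⟩
    rw [he] at this
    exact this
  · have hbdd : BddAbove A := ⟨b, fun c hcA => hcA.1.2.le⟩
    obtain ⟨c₀, hc₀⟩ := hne
    set e := sSup A with hedef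
    have hc₀e : c₀ ≤ e := le_csSup hbdd hc₀
    have hae : a < e := hc₀.1.1.trans_le hc₀e
    have heb : e ≤ b := csSup_le ⟨c₀, hc₀⟩ fun c hcA => hcA.1.2.le
    have hleft : IsAffineOn g (Ico a e) := isAffineOn_Ico hae fun c hcI => by
      obtain ⟨c', hc', hlt⟩ := exists_lt_of_lt_csSup ⟨c₀, hc₀⟩ hcI.2
      exact hc'.2.mono (Icc_subset_Icc le_rfl hlt.le)
    rcases heb.eq_or_lt with heq | heb
    · rw [heq] at hleft
      exact Or.inl (hleft.mono Ioo_subset_Ico_self)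
    · refine Or.inr ⟨e, ⟨hae, heb⟩, ?_, ?_⟩
      · exact hleft.of_subset_closure (hc.mono (Icc_subset_Icc le_rfl heb.le)) Ico_subset_Icc_self
          (by rw [closure_Ico hae.ne])
      · refine (isAffineOn_Ioc heb fun c hcI => (h c ⟨hae.trans hcI.1, hcI.2⟩).resolve_left
          fun h1 => ?_).of_subset_closure (hc.mono (Icc_subset_Icc hae.le le_rfl))
          Ioc_subset_Icc_self (by rw [closure_Ioc heb.ne])
        exact absurd (le_csSup hbdd (⟨⟨hae.trans hcI.1, hcI.2⟩, h1⟩ : c ∈ A)) (not_le.2 hcI.1)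

/-- The intersection of two transversal symmetric strips is a parallelogram. -/
theorem isParallelogram_strips {α₁ β₁ k₁ α₂ β₂ k₂ : ℝ} (hD : α₁ * β₂ - α₂ * β₁ ≠ 0) (hk₁ : 0 < k₁)
    (hk₂ : 0 < k₂) : IsParallelogram {x : EuclideanSpace ℝ (Fin 2) |
      |α₁ * x 0 + β₁ * x 1| < k₁ ∧ |α₂ * x 0 + β₂ * x 1| < k₂} := by
  set D := α₁ * β₂ - α₂ * β₁ with hDdef
  refine ⟨!₂[(-k₁ * β₂ + k₂ * β₁) / D, (-k₂ * α₁ + k₁ * α₂) / D],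
    !₂[2 * k₁ * β₂ / D, -(2 * k₁ * α₂) / D], !₂[-(2 * k₂ * β₁) / D, 2 * k₂ * α₁ / D], ?_, ?_⟩
  · rw [LinearIndependent.pair_iff]
    intro s t hst
    rw [combo_pair] at hst
    have h0 := congrArg (fun x : EuclideanSpace ℝ (Fin 2) => x 0) hst
    have h1 := congrArg (fun x : EuclideanSpace ℝ (Fin 2) => x 1) hst
    simp at h0 h1
    field_simp at h0 h1
    have e1 : 2 * k₁ * D * s = 0 := by
      rw [hDdef]; linear_combination α₁ * h0 + β₁ * h1
    have e2 : 2 * k₂ * D * t = 0 := by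
      rw [hDdef]; linear_combination α₂ * h0 + β₂ * h1
    have n1 : 2 * k₁ * D ≠ 0 := mul_ne_zero (by positivity) hD
    have n2 : 2 * k₂ * D ≠ 0 := mul_ne_zero (by positivity) hD
    exact ⟨(mul_eq_zero.1 e1).resolve_left n1, (mul_eq_zero.1 e2).resolve_left n2⟩
  · ext x
    simp only [mem_ofPred_eq]
    constructor
    · rintro ⟨h1, h2⟩
      rw [abs_lt] at h1 h2
      refine ⟨(α₁ * x 0 + β₁ * x 1 + k₁) / (2 * k₁), ⟨div_pos (by linarith) (by linarith), ?_⟩,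
        (α₂ * x 0 + β₂ * x 1 + k₂) / (2 * k₂), ⟨div_pos (by linarith) (by linarith), ?_⟩, ?_⟩
      · rw [div_lt_one (by linarith)]; linarith
      · rw [div_lt_one (by linarith)]; linarith
      · ext i
        fin_cases i
        · simp
          field_simp
          rw [hDdef]; ring
        · simp
          field_simp
          rw [hDdef]; ring
    · rintro ⟨s, hs, t, ht, rfl⟩
      have e1 : α₁ * (!₂[(-k₁ * β₂ + k₂ * β₁) / D, (-k₂ * α₁ + k₁ * α₂) / D] +
          s • !₂[2 * k₁ * β₂ / D, -(2 * k₁ * α₂) / D] +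
          t • !₂[-(2 * k₂ * β₁) / D, 2 * k₂ * α₁ / D] : EuclideanSpace ℝ (Fin 2)) 0 +
          β₁ * (!₂[(-k₁ * β₂ + k₂ * β₁) / D, (-k₂ * α₁ + k₁ * α₂) / D] +
          s • !₂[2 * k₁ * β₂ / D, -(2 * k₁ * α₂) / D] +
          t • !₂[-(2 * k₂ * β₁) / D, 2 * k₂ * α₁ / D] : EuclideanSpace ℝ (Fin 2)) 1 =
          k₁ * (2 * s - 1) := by
        simp
        field_simp
        rw [hDdef]; ring
      have e2 : α₂ * (!₂[(-k₁ * β₂ + k₂ * β₁) / D, (-k₂ * α₁ + k₁ * α₂) / D] +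
          s • !₂[2 * k₁ * β₂ / D, -(2 * k₁ * α₂) / D] +
          t • !₂[-(2 * k₂ * β₁) / D, 2 * k₂ * α₁ / D] : EuclideanSpace ℝ (Fin 2)) 0 +
          β₂ * (!₂[(-k₁ * β₂ + k₂ * β₁) / D, (-k₂ * α₁ + k₁ * α₂) / D] +
          s • !₂[2 * k₁ * β₂ / D, -(2 * k₁ * α₂) / D] +
          t • !₂[-(2 * k₂ * β₁) / D, 2 * k₂ * α₁ / D] : EuclideanSpace ℝ (Fin 2)) 1 =
          k₂ * (2 * t - 1) := by
        simp
        field_simp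
        rw [hDdef]; ring
      rw [e1, e2, abs_lt, abs_lt]
      obtain ⟨hs0, hs1⟩ := hs
      obtain ⟨ht0, ht1⟩ := ht
      refine ⟨⟨?_, ?_⟩, ?_, ?_⟩ <;> nlinarith

section Classification

variable {b : ℝ} {g : ℝ → ℝ}

theorem IsProfile.isParallelogram_of_isAffineOn (h : IsProfile b g)
    (ha : IsAffineOn g (Ioo (-b) b)) : IsParallelogram (profileBody b g) := by
  obtain ⟨k, p, hkp⟩ := ha
  have hk : 0 < k := by
    have h1 := hkp 0 h.zero_mem_Ioo
    have h2 := h.zero_pos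
    linarith
  convert isParallelogram_strips (α₁ := 1) (β₁ := -p) (k₁ := k) (α₂ := 0) (β₂ := 1) (k₂ := b)
    (by norm_num) hk h.height_pos using 1
  ext x
  simp only [profileBody, mem_ofPred_eq, abs_lt, mem_Ioo]
  constructor
  · rintro ⟨hy, h1, h2⟩
    have e1 := hkp _ hy
    have e2 := hkp _ (neg_mem_Ioo_neg hy)
    refine ⟨⟨?_, ?_⟩, ?_, ?_⟩ <;> linarith [hy.1, hy.2]
  · rintro ⟨⟨h1, h2⟩, h3, h4⟩
    have hy : x 1 ∈ Ioo (-b) b := ⟨by linarith, by linarith⟩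
    have e1 := hkp _ hy
    have e2 := hkp _ (neg_mem_Ioo_neg hy)
    exact ⟨hy, by linarith, by linarith⟩

theorem IsProfile.isParallelogram_of_corner (h : IsProfile b g) (hends : g b + g (-b) = 0) {c : ℝ}
    (hc : c ∈ Ioo (-b) b) (h1 : IsAffineOn g (Icc (-b) c)) (h2 : IsAffineOn g (Icc c b)) :
    IsParallelogram (profileBody b g) := by
  obtain ⟨k₁, p₁, hl⟩ := h1
  obtain ⟨k₂, p₂, hr⟩ := h2
  have hb := h.height_pos
  have ec : k₁ + p₁ * c = k₂ + p₂ * c :=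
    (hl c ⟨hc.1.le, le_rfl⟩).symm.trans (hr c ⟨le_rfl, hc.2.le⟩)
  have eb : (p₁ - p₂) * b = k₁ + k₂ := by
    rw [hr b ⟨hc.2.le, le_rfl⟩, hl (-b) ⟨le_rfl, hc.1.le⟩] at hends
    linarith
  have hk : 0 < k₁ ∨ 0 < k₂ := by
    rcases le_total 0 c with h0 | h0
    · have := hl 0 ⟨by linarith, h0⟩
      left; linarith [h.zero_pos]
    · have := hr 0 ⟨h0, hb.le⟩
      right; linarith [h.zero_pos]
  have hp : 0 < p₁ - p₂ := by
    -- the lines meet at `c`, and one of the intercepts is positive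
    by_contra! hle
    have hk12 : k₁ + k₂ ≤ 0 := by rw [← eb]; exact mul_nonpos_of_nonpos_of_nonneg hle hb.le
    have hd : k₁ - k₂ = -(p₁ - p₂) * c := by linarith
    rcases hk with hk | hk
    · nlinarith [hc.1, hc.2]
    · nlinarith [hc.1, hc.2]
  have hle1 : ∀ y ∈ Icc (-b) b, g y ≤ k₁ + p₁ * y := by
    intro y hy
    rcases le_total y c with hyc | hyc
    · exact (hl y ⟨hy.1, hyc⟩).le
    · rw [hr y ⟨hyc, hy.2⟩]
      nlinarith
  have hle2 : ∀ y ∈ Icc (-b) b, g y ≤ k₂ + p₂ * y := by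
    intro y hy
    rcases le_total y c with hyc | hyc
    · rw [hl y ⟨hy.1, hyc⟩]
      nlinarith
    · exact (hr y ⟨hyc, hy.2⟩).le
  have hk₁ : 0 < k₁ := by linarith [hle1 0 h.zero_mem_Icc, h.zero_pos]
  have hk₂ : 0 < k₂ := by linarith [hle2 0 h.zero_mem_Icc, h.zero_pos]
  have hmin : ∀ y ∈ Icc (-b) b, ∀ x, x < k₁ + p₁ * y → x < k₂ + p₂ * y → x < g y := by
    intro y hy x hx1 hx2
    rcases le_total y c with hyc | hyc
    · rwa [hl y ⟨hy.1, hyc⟩]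
    · rwa [hr y ⟨hyc, hy.2⟩]
  convert isParallelogram_strips (α₁ := 1) (β₁ := -p₁) (k₁ := k₁) (α₂ := 1) (β₂ := -p₂) (k₂ := k₂)
    (by intro h0; linarith) hk₁ hk₂ using 1
  ext x
  simp only [profileBody, mem_ofPred_eq, abs_lt]
  constructor
  · rintro ⟨hy, hx1, hx2⟩
    have hy' := Ioo_subset_Icc_self hy
    have a1 := hle1 _ hy'
    have a2 := hle2 _ hy'
    have a3 := hle1 _ (neg_mem_Icc_neg hy')
    have a4 := hle2 _ (neg_mem_Icc_neg hy')
    refine ⟨⟨?_, ?_⟩, ?_, ?_⟩ <;> linarith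
  · rintro ⟨⟨a1, a2⟩, a3, a4⟩
    have hy : x 1 ∈ Ioo (-b) b := by
      constructor
      · by_contra! hle
        nlinarith
      · by_contra! hle
        nlinarith
    have hy' := Ioo_subset_Icc_self hy
    refine ⟨hy, ?_, hmin _ hy' _ (by linarith) (by linarith)⟩
    have := hmin _ (neg_mem_Icc_neg hy') (-x 0) (by linarith) (by linarith)
    linarith

/-! ### Admissible perturbations of a profile with several corners -/

/-- The difference of `g` and its supporting line of slope `p` at `c`, on the right of `c`, extended
by `0` to the left. It is nonpositive. -/
def tangentGap (g : ℝ → ℝ) (c p y : ℝ) : ℝ :=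
  g (max y c) - (g c + p * (max y c - c))

theorem tangentGap_of_le {c p y : ℝ} (hy : y ≤ c) : tangentGap g c p y = 0 := by
  simp [tangentGap, max_eq_right hy]

theorem tangentGap_of_ge {c p y : ℝ} (hy : c ≤ y) :
    tangentGap g c p y = g y - (g c + p * (y - c)) := by
  simp [tangentGap, max_eq_left hy]

/-- The tangent gap splits `g` into two concave functions, each carrying the curvature of `g` on one
side of `c`. -/
theorem concaveOn_tangentGap (hg : ConcaveOn ℝ (Icc (-b) b) g) {c p : ℝ} (hc : c ∈ Icc (-b) b)
    (hp : ∀ z ∈ Icc (-b) b, g z ≤ g c + p * (z - c)) :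
    ConcaveOn ℝ (Icc (-b) b) (tangentGap g c p) ∧
      ConcaveOn ℝ (Icc (-b) b) (fun y => g y - tangentGap g c p y) := by
  set ψ : ℝ → ℝ := fun y => g y - (g c + p * (y - c)) with hψ
  have hψc : ψ c = 0 := by simp [hψ]
  have hψ0 : ∀ y ∈ Icc (-b) b, ψ y ≤ 0 := fun y hy => by
    have := hp y hy
    simp only [hψ]; linarith
  have hψconc : ∀ x ∈ Icc (-b) b, ∀ y ∈ Icc (-b) b, ∀ s t : ℝ, 0 ≤ s → 0 ≤ t → s + t = 1 →
      s * ψ x + t * ψ y ≤ ψ (s * x + t * y) := by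
    intro x hx y hy s t hs ht hst
    have := hg.2 hx hy hs ht hst
    simp only [smul_eq_mul] at this
    simp only [hψ]
    have e : s * (g c + p * (x - c)) + t * (g c + p * (y - c)) =
        g c + p * (s * x + t * y - c) := by linear_combination (g c - p * c) * hst
    linarith
  -- `ψ` increases up to `c` and decreases afterwards
  have hψmono : ∀ u ∈ Icc (-b) b, ∀ v ∈ Icc (-b) b, u ∈ segment ℝ c v → ψ v ≤ ψ u := by
    rintro u - v hv ⟨s, t, hs, ht, hst, rfl⟩
    have := hψconc c hc v hv s t hs ht hst
    rw [hψc] at this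
    have := hψ0 v hv
    simp only [smul_eq_mul]
    nlinarith
  have hmaxmem : ∀ y ∈ Icc (-b) b, max y c ∈ Icc (-b) b := fun y hy =>
    ⟨hy.1.trans (le_max_left _ _), max_le hy.2 hc.2⟩
  have hminmem : ∀ y ∈ Icc (-b) b, min y c ∈ Icc (-b) b := fun y hy =>
    ⟨le_min hy.1 hc.1, (min_le_left _ _).trans hy.2⟩
  constructor
  · refine ⟨convex_Icc _ _, fun x hx y hy s t hs ht hst => ?_⟩
    have hz := convex_Icc (-b) b (hmaxmem x hx) (hmaxmem y hy) hs ht hst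
    have hw := hmaxmem _ (convex_Icc (-b) b hx hy hs ht hst)
    simp only [smul_eq_mul] at hz hw ⊢
    have h1 := hψconc _ (hmaxmem x hx) _ (hmaxmem y hy) s t hs ht hst
    have h2 := hψmono _ hw _ hz (by
      have hle : max (s * x + t * y) c ≤ s * max x c + t * max y c := by
        refine max_le ?_ ?_
        · exact add_le_add (mul_le_mul_of_nonneg_left (le_max_left _ _) hs)
            (mul_le_mul_of_nonneg_left (le_max_left _ _) ht)
        · calc c = s * c + t * c := by rw [← add_mul, hst, one_mul]
            _ ≤ _ := add_le_add (mul_le_mul_of_nonneg_left (le_max_right _ _) hs)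
              (mul_le_mul_of_nonneg_left (le_max_right _ _) ht)
      rw [segment_eq_Icc ((le_max_right _ _).trans hle)]
      exact ⟨le_max_right _ _, hle⟩)
    exact h1.trans h2
  · have e : ∀ y, g y - tangentGap g c p y = ψ (min y c) + (g c + p * (y - c)) := by
      intro y
      rcases le_total y c with h | h
      · rw [tangentGap_of_le h, min_eq_left h]; simp only [hψ]; ring
      · rw [tangentGap_of_ge h, min_eq_right h, hψc]; ring
    refine ⟨convex_Icc _ _, fun x hx y hy s t hs ht hst => ?_⟩
    simp only [e]
    have hz := convex_Icc (-b) b (hminmem x hx) (hminmem y hy) hs ht hst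
    have hw := hminmem _ (convex_Icc (-b) b hx hy hs ht hst)
    simp only [smul_eq_mul] at hz hw ⊢
    have h1 := hψconc _ (hminmem x hx) _ (hminmem y hy) s t hs ht hst
    have h2 := hψmono _ hw _ hz (by
      have hle : s * min x c + t * min y c ≤ min (s * x + t * y) c := by
        refine le_min ?_ ?_
        · exact add_le_add (mul_le_mul_of_nonneg_left (min_le_left _ _) hs)
            (mul_le_mul_of_nonneg_left (min_le_left _ _) ht)
        · calc _ ≤ s * c + t * c := add_le_add (mul_le_mul_of_nonneg_left (min_le_right _ _) hs)
                (mul_le_mul_of_nonneg_left (min_le_right _ _) ht)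
            _ = c := by rw [← add_mul, hst, one_mul]
      rw [segment_symm, segment_eq_Icc (hle.trans (min_le_right _ _))]
      exact ⟨hle, min_le_right _ _⟩)
    have e3 : s * (g c + p * (x - c)) + t * (g c + p * (y - c)) =
        g c + p * (s * x + t * y - c) := by linear_combination (g c - p * c) * hst
    linarith

/-- If the top of a local minimizer is an edge, then its sides are straight: otherwise the
non-linear perturbation `g - g 0` is admissible. -/
theorem isAffineOn_of_flat_top (h : IsProfile b g) (hc : ContinuousOn g (Icc (-b) b))
    (hmin : IsLocalMinimizer (profileBody b g)) (hends : 0 < g b + g (-b)) :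
    IsAffineOn g (Ioo (-b) b) := by
  obtain ⟨γ, hγ⟩ := linear_of_isLocalMinimizer (β := fun y => g y - g 0) h hc hmin
    (t₀ := 1) one_pos (fun t ht => by
      have h1 := (h.concave.smul (c := 1 + t) (by linarith [(abs_le.1 ht).1])).add
        (concaveOn_const (-(t * g 0)) (convex_Icc (-b) b))
      refine h1.congr fun y _ => ?_
      simp only [Pi.add_apply, smul_eq_mul]
      ring) (sub_self _) (Or.inl hends)
  exact ⟨g 0, γ, fun y hy => by have := hγ y hy; linarith⟩

/-- If the top of a local minimizer is a vertex, then at every height its right boundary is straight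
below or above. The perturbations in the span of `1`, `g` and the tangent gap at `c` are
constrained by two linear conditions, so one with coefficient `1` of the gap is admissible. -/
theorem isAffineOn_or_of_vertex_top (h : IsProfile b g) (hc : ContinuousOn g (Icc (-b) b))
    (hmin : IsLocalMinimizer (profileBody b g)) (hends : g b + g (-b) = 0) {c : ℝ}
    (hcI : c ∈ Ioo (-b) b) : IsAffineOn g (Icc (-b) c) ∨ IsAffineOn g (Icc c b) := by
  have hb := h.height_pos
  have hg0 := h.zero_pos
  obtain ⟨p, hp⟩ := exists_supergradient h.concave (y := c) (by rw [interior_Icc]; exact hcI)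
  obtain ⟨hκ, hκ'⟩ := concaveOn_tangentGap h.concave (Ioo_subset_Icc_self hcI) hp
  set κ := tangentGap g c p with hκdef
  set c₀ := -κ b / 2 with hc₀
  set a := (κ b / 2 - κ 0) / g 0 with hadef
  have ha : a * g 0 = κ b / 2 - κ 0 := div_mul_cancel₀ _ hg0.ne'
  have hκb : κ (-b) = 0 := tangentGap_of_le hcI.1.le
  obtain ⟨γ, hγ⟩ := linear_of_isLocalMinimizer (β := fun y => c₀ + a * g y + κ y) h hc hmin
    (t₀ := 1 / (|a| + 1)) (by positivity) (fun t ht => by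
      rw [le_div_iff₀ (by positivity)] at ht
      have hta : -(t * a) ≤ |t| * |a| := by rw [← abs_mul]; exact neg_le_abs _
      rcases le_total 0 t with h0 | h0
      · rw [abs_of_nonneg h0] at ht hta
        have h1 := ((h.concave.smul (c := 1 + t * a) (by linarith)).add (hκ.smul h0)).add
          (concaveOn_const (t * c₀) (convex_Icc (-b) b))
        refine h1.congr fun y _ => ?_
        simp only [Pi.add_apply, smul_eq_mul]
        ring
      · rw [abs_of_nonpos h0] at ht hta
        have h1 := ((h.concave.smul (c := 1 + t * a + t) (by linarith)).add
          (hκ'.smul (neg_nonneg.2 h0))).add (concaveOn_const (t * c₀) (convex_Icc (-b) b))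
        refine h1.congr fun y _ => ?_
        simp only [Pi.add_apply, smul_eq_mul]
        ring)
    (by simp only [ha, hc₀]; ring)
    (Or.inr (by
      have : a * g b + a * g (-b) = 0 := by rw [← mul_add, hends, mul_zero]
      simp only [hκb, hc₀]
      linarith))
  have hleft : ∀ y ∈ Ioc (-b) c, c₀ + a * g y = γ * y := fun y hy => by
    have h1 := hγ y ⟨hy.1, hy.2.trans_lt hcI.2⟩
    have h2 : κ y = 0 := tangentGap_of_le hy.2
    simp only [h2] at h1
    linarith
  by_cases ha0 : a = 0
  · right
    simp only [ha0, zero_mul, add_zero] at hleft hγ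
    obtain ⟨d, hd⟩ := nonempty_Ioo.2 hcI.1
    obtain ⟨e1, e2⟩ := affine_coeff_unique (k := c₀) (p := 0) (k' := 0) (p' := γ) hd.2.ne
      (by linarith [hleft d ⟨hd.1, hd.2.le⟩]) (by linarith [hleft c ⟨hcI.1, le_rfl⟩])
    have hright : IsAffineOn g (Ico c b) := by
      refine ⟨g c - p * c, p, fun y hy => ?_⟩
      have h1 := hγ y ⟨hcI.1.trans_le hy.1, hy.2⟩
      have h2 : κ y = g y - (g c + p * (y - c)) := tangentGap_of_ge hy.1
      rw [← e2] at h1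
      linarith
    exact hright.of_subset_closure (hc.mono (Icc_subset_Icc hcI.1.le le_rfl)) Ico_subset_Icc_self
      (by rw [closure_Ico hcI.2.ne])
  · left
    have : IsAffineOn g (Ioc (-b) c) := by
      refine ⟨-c₀ / a, γ / a, fun y hy => ?_⟩
      have := hleft y hy
      field_simp
      linarith
    exact this.of_subset_closure (hc.mono (Icc_subset_Icc le_rfl hcI.2.le)) Ioc_subset_Icc_self
      (by rw [closure_Ioc hcI.1.ne])

end Classification

end MahlerVolume

theorem theorem2 (K : Set (EuclideanSpace ℝ (Fin 2)))
    (hK : MahlerVolume.IsLocalMinimizer K) : MahlerVolume.IsParallelogram K := by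
  obtain ⟨b, g, h, hc, rfl⟩ := MahlerVolume.exists_profile hK.1
  rcases h.ends.lt_or_eq with hends | hends
  · exact h.isParallelogram_of_isAffineOn
      (MahlerVolume.isAffineOn_of_flat_top h hc hK hends)
  · rcases MahlerVolume.isAffineOn_or_exists_corner (by linarith [h.height_pos]) hc
      (fun c hcI => MahlerVolume.isAffineOn_or_of_vertex_top h hc hK hends.symm hcI) with
      ha | ⟨c, hcI, h1, h2⟩
    · exact h.isParallelogram_of_isAffineOn ha
    · exact h.isParallelogram_of_corner hends.symm hcI h1 h2
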